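/- Let $\mu>-1$ and let $\Delta_\mu=\partial_x^2+(\tfrac14-\mu^2)x^{-2}$ be the Bessel operator on $(0,\infty)$. Let $$W_\tau^\mu(x,y)=\frac{(xy)^{1/2}}{2\tau}\,I_\mu\!\left(\frac{xy}{2\tau}\right)e^{-\frac{x^2+y^2}{4\tau}},\qquad \tau,x,y>0,$$ where $I_\mu(z)=\sum_{k=0}^\infty \frac{(z/2)^{2k+\mu}}{k!\,\Gamma(k+\mu+1)}$ is the modified Bessel function of the first kind. Let $f:\mathbb R\times(0,\infty)\to\mathbb C$ be in $L^\infty(\mathbb R\times(0,\infty))$ with compact support in $\mathbb R\times(0,\infty)$, and put $$u(t,x)=\int_0^\infty\!\!\int_0^\infty W_\tau^\mu(x,y)f(t-\tau,y)\,dy\,d\tau .$$ Then for every $(t,x)\in\mathbb R\times(0,\infty)$ this integral converges absolutely. If moreover $f\in C^2(\mathbb R\times(0,\infty))$, then for every $(t,x)\in\mathbb R\times(0,\infty)$ the derivatives $\partial_tu$, $\partial_xu$ and $\partial_x^2u$ exist at $(t,x)$, $$\partial_t u(t,x)=\Delta_\mu u(t,x)+f(t,x),$$ and $$\partial_t u(t,x)=\lim_{\epsilon\to0^+}\int_\epsilon^\infty\!\!\int_0^\infty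 \partial_\tau W_\tau^\mu(x,y)f(t-\tau,y)\,dy\,d\tau+f(t,x)=\lim_{\epsilon\to0^+}\int_{\Omega_\epsilon(x)}\partial_\tau W_\tau^\mu(x,y)f(t-\tau,y)\,dy\,d\tau+A f(t,x),$$ $$\partial_x^2 u(t,x)=\lim_{\epsilon\to0^+}\int_\epsilon^\infty\!\!\int_0^\infty \partial_x^2 W_\tau^\mu(x,y)f(t-\tau,y)\,dy\,d\tau=\lim_{\epsilon\to0^+}\int_{\Omega_\epsilon(x)}\partial_x^2 W_\tau^\mu(x,y)f(t-\tau,y)\,dy\,d\tau-(1-A) f(t,x),$$ where all the integrals for fixed $\epsilon>0$ converge absolutely, all the limits exist, $\Omega_\epsilon(x)=\{(\tau,y)\in(0,\infty)^2:\ \max\{\tau^{1/2},|x-y|\}>\epsilon\}$ and $A=\frac1{\sqrt\pi}\int_0^1e^{-w^2/4}\,dw$. -/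

import Mathlib

open MeasureTheory Set Filter Topology

noncomputable section

/-- The modified Bessel function of the first kind and order `ν`,
`I_ν(z) = ∑ₖ (z/2)^(2k+ν) / (k! Γ(k+ν+1))`, for real `z > 0`. -/
def besselI (ν z : ℝ) : ℝ :=
  ∑' k : ℕ, (z / 2) ^ (2 * (k : ℝ) + ν) / ((k.factorial : ℝ) * Real.Gamma ((k : ℝ) + ν + 1))

/-- The heat kernel of the Bessel operator,
`W_τ^μ(x,y) = (xy)^(1/2) / (2τ) * I_μ(xy/(2τ)) * exp(-(x²+y²)/(4τ))`, for `τ, x, y > 0`. -/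
def besselHeatKernel (μ τ x y : ℝ) : ℝ :=
  Real.sqrt (x * y) / (2 * τ) * besselI μ (x * y / (2 * τ)) *
    Real.exp (-(x ^ 2 + y ^ 2) / (4 * τ))

/-- `∂/∂τ W_τ^μ(x,y)`. -/
def besselHeatKernelDt (μ τ x y : ℝ) : ℝ :=
  deriv (fun s => besselHeatKernel μ s x y) τ

/-- `∂²/∂x² W_τ^μ(x,y)`. -/
def besselHeatKernelDxx (μ τ x y : ℝ) : ℝ :=
  deriv (deriv (fun z => besselHeatKernel μ τ z y)) x

/-- `u(t,x) = ∫₀^∞ ∫₀^∞ W_τ^μ(x,y) f(t-τ,y) dy dτ`. -/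
def besselPotential (μ : ℝ) (f : ℝ × ℝ → ℂ) (t x : ℝ) : ℂ :=
  ∫ τ in Ioi (0 : ℝ), ∫ y in Ioi (0 : ℝ), (besselHeatKernel μ τ x y : ℂ) * f (t - τ, y)

/-- The half plane `ℝ × (0,∞)`. -/
def halfPlane : Set (ℝ × ℝ) := univ ×ˢ Ioi (0 : ℝ)

/-- The Bessel operator `Δ_μ = d²/dx² + (1/4 - μ²) x⁻²` acting on functions on `(0,∞)`. -/
def besselOperator (μ : ℝ) (g : ℝ → ℂ) (x : ℝ) : ℂ :=
  deriv (deriv g) x + (((1 / 4 - μ ^ 2) / x ^ 2 : ℝ) : ℂ) * g x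

/-- `f` belongs to `L^∞(ℝ × (0,∞))` and its (essential) support is a compact subset of
`ℝ × (0,∞)`. Values of `f` off `ℝ × (0,∞)` play no role. -/
def IsBoundedCompactlySupported (f : ℝ × ℝ → ℂ) : Prop :=
  MemLp f ⊤ (volume.restrict halfPlane) ∧
    ∃ K : Set (ℝ × ℝ), IsCompact K ∧ K ⊆ halfPlane ∧
      ∀ᵐ p ∂(volume.restrict (halfPlane \ K)), f p = 0

/-- The parabolic region
`Ω_ε(x) = {(τ,y) ∈ (0,∞)² : max {τ^(1/2), |x-y|} > ε}`. -/
def parabolicRegion (ε x : ℝ) : Set (ℝ × ℝ) :=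
  {p | 0 < p.1 ∧ 0 < p.2 ∧ ε < max (Real.sqrt p.1) |x - p.2|}

/-- `A = π^(-1/2) ∫₀¹ exp(-w²/4) dw`. -/
def constA : ℝ := (Real.sqrt Real.pi)⁻¹ * ∫ w in (0 : ℝ)..1, Real.exp (-w ^ 2 / 4)

end

/-! Put g(z) = √z e^{-z} I_μ(z). Completing the square gives W_τ(x,y) = (2τ)^{-1/2} g(xy/2τ)
e^{-(x-y)²/4τ}, and g(z) → (2π)^{-1/2} as z → ∞. The support of f keeps y away from 0 and τ bounded,
so xy/2τ stays away from 0, where g is bounded. Hence W is dominated by an ordinary Gaussian kernel,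
which gives absolute convergence, and y = x + √τ w shows that it is an approximate identity as τ →
0. The limit of g comes from Poisson's integral when μ > -1/2 and from the three-term recurrence
when -1 < μ ≤ -1/2.

Write φ(τ,y) = f(t-τ,y) and ψ(τ,y) = ∂_t f(t-τ,y) = -∂_τ φ. The time derivative of u falls on f, so
∂_t u = ∬ Wψ. Integration by parts in τ over τ > ε gives ∬ ∂_τW φ = ∬ Wψ - ∫ W_ε φ(ε,·), which tends
to ∂_t u - f. The region Ω_ε adds the piece τ ≤ ε², |x-y| > ε to τ > ε². There the boundary term at
τ = 0 vanishes, and the one at τ = ε² tends to the Gaussian mass of |w| > 1, namely 1 - A, times f.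

In space, the heat equation ∂_x²W = ∂_τW - (1/4-μ²)x^{-2}W turns the truncated integrals of ∂_x²W
into those of ∂_τW, with limit g₀ = ∂_t u - f - (1/4-μ²)x^{-2}u. To identify g₀ with ∂_x²u, the
truncated potentials are expanded by Taylor's formula with integral remainder and ε → 0
(`hasDerivAt_deriv_potential`). The limiting formula, with g₀ continuous, makes u twice
differentiable, and the equation is then the definition of g₀. -/

/-! ### Power series of the Bessel function and its recurrences -/

/-- The entire function `Φ_ν(w) = ∑ₖ w^k / (k! Γ(k+ν+1))`, for which
`I_ν(z) = (z/2)^ν Φ_ν(z²/4)`. -/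
noncomputable def besselSeries (ν w : ℝ) : ℝ :=
  ∑' k : ℕ, w ^ k / ((k.factorial : ℝ) * Real.Gamma ((k : ℝ) + ν + 1))

theorem gamma_add_pos {ν : ℝ} (hν : -1 < ν) (k : ℕ) : 0 < Real.Gamma ((k : ℝ) + ν + 1) :=
  Real.Gamma_pos_of_pos (by have : (0 : ℝ) ≤ k := k.cast_nonneg; linarith)

theorem gamma_succ_add {ν : ℝ} (hν : -1 < ν) (k : ℕ) :
    Real.Gamma ((k : ℝ) + ν + 2) = ((k : ℝ) + ν + 1) * Real.Gamma ((k : ℝ) + ν + 1) := by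
  have h : (k : ℝ) + ν + 1 ≠ 0 := by
    have : (0 : ℝ) ≤ k := k.cast_nonneg
    linarith
  rw [← Real.Gamma_add_one h]
  congr 1
  ring

/-- From k = 1 on, Γ(k+ν+1) is nondecreasing in k, since each step multiplies it by k+ν+1 ≥ 1. The
index k = 0 is separate because ν+1 may be less than 1. The bound lets the exponential series
dominate `besselSeries`. -/
theorem exists_inv_gamma_le {ν : ℝ} (hν : -1 < ν) :
    ∃ C : ℝ, 0 ≤ C ∧ ∀ k : ℕ, (Real.Gamma ((k : ℝ) + ν + 1))⁻¹ ≤ C := by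
  have h1 : ∀ k : ℕ, (Real.Gamma (((k + 1 : ℕ) : ℝ) + ν + 1))⁻¹ ≤
      (Real.Gamma (((1 : ℕ) : ℝ) + ν + 1))⁻¹ := by
    intro k
    induction k with
    | zero => simp
    | succ k ih =>
      refine le_trans ?_ ih
      have hp := gamma_add_pos hν (k + 1)
      refine inv_anti₀ hp ?_
      have h := gamma_succ_add hν (k + 1)
      have e : (((k + 1 + 1 : ℕ) : ℝ) + ν + 1) = ((k + 1 : ℕ) : ℝ) + ν + 2 := by
        push_cast; ring
      rw [e, h]
      have : (1 : ℝ) ≤ ((k + 1 : ℕ) : ℝ) + ν + 1 := by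
        have : (0 : ℝ) ≤ k := k.cast_nonneg
        push_cast
        linarith
      nlinarith
  refine ⟨(Real.Gamma (((0 : ℕ) : ℝ) + ν + 1))⁻¹ + (Real.Gamma (((1 : ℕ) : ℝ) + ν + 1))⁻¹,
    ?_, ?_⟩
  · have := inv_pos.2 (gamma_add_pos hν 0)
    have := inv_pos.2 (gamma_add_pos hν 1)
    positivity
  · intro k
    have h2 := inv_pos.2 (gamma_add_pos hν 0)
    have h3 := inv_pos.2 (gamma_add_pos hν 1)
    rcases k with _ | k
    · linarith
    · linarith [h1 k]

theorem summable_besselSeries {ν : ℝ} (hν : -1 < ν) (w : ℝ) :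
    Summable fun k : ℕ => w ^ k / ((k.factorial : ℝ) * Real.Gamma ((k : ℝ) + ν + 1)) := by
  obtain ⟨C, hC, h⟩ := exists_inv_gamma_le hν
  refine Summable.of_norm_bounded ((Real.summable_pow_div_factorial |w|).mul_left C) fun k => ?_
  have hp := gamma_add_pos hν k
  rw [norm_div, norm_mul, norm_pow, Real.norm_eq_abs, Real.norm_of_nonneg hp.le,
    Real.norm_of_nonneg (Nat.cast_nonneg _), div_mul_eq_div_div, div_eq_mul_inv _ (Real.Gamma _),
    mul_comm]
  exact mul_le_mul_of_nonneg_right (h k) (by positivity)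

/-- Termwise differentiation: k/k! = 1/(k-1)!, and the index shift moves the lost unit into the
order. -/
theorem hasDerivAt_besselSeries {ν : ℝ} (hν : -1 < ν) (w : ℝ) :
    HasDerivAt (besselSeries ν) (besselSeries (ν + 1) w) w := by
  obtain ⟨C, hC, h⟩ := exists_inv_gamma_le hν
  -- A ball containing both 0 and w, on which the differentiated terms have a summable bound.
  set R : ℝ := |w| + 1
  have hR : 0 < R := by positivity
  have hs : Summable fun k : ℕ => C * ((k : ℝ) * R ^ (k - 1) / (k.factorial : ℝ)) := by
    refine Summable.mul_left C ?_
    rw [← summable_nat_add_iff 1]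
    refine (Real.summable_pow_div_factorial R).congr fun k => ?_
    rw [Nat.factorial_succ]
    have : (k.factorial : ℝ) ≠ 0 := by positivity
    push_cast
    field_simp
  have key := hasDerivAt_tsum_of_isPreconnected (t := Metric.ball (0 : ℝ) R) (y₀ := 0) (y := w)
    (g := fun (k : ℕ) w => w ^ k / ((k.factorial : ℝ) * Real.Gamma ((k : ℝ) + ν + 1)))
    (g' := fun (k : ℕ) w =>
      ((k : ℝ) * w ^ (k - 1)) / ((k.factorial : ℝ) * Real.Gamma ((k : ℝ) + ν + 1)))
    hs Metric.isOpen_ball (convex_ball _ _).isPreconnected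
    (fun k y _ => (hasDerivAt_pow k y).div_const _) ?_ (Metric.mem_ball_self hR)
    (summable_besselSeries hν 0) (by simp [R])
  · refine key.congr_deriv ?_
    have hsum : Summable fun k : ℕ =>
        ((k : ℝ) * w ^ (k - 1)) / ((k.factorial : ℝ) * Real.Gamma ((k : ℝ) + ν + 1)) := by
      rw [← summable_nat_add_iff 1]
      refine (summable_besselSeries (ν := ν + 1) (by linarith) w).congr fun k => ?_
      rw [Nat.factorial_succ]
      have : (k.factorial : ℝ) ≠ 0 := by positivity
      have e : ((k + 1 : ℕ) : ℝ) + ν + 1 = (k : ℝ) + (ν + 1) + 1 := by push_cast; ring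
      rw [e]
      push_cast
      rw [mul_assoc, mul_div_mul_left _ _ (by positivity)]
    rw [hsum.tsum_eq_zero_add, besselSeries]
    simp only [Nat.cast_zero, zero_mul, zero_div, zero_add]
    refine tsum_congr fun k => ?_
    rw [Nat.factorial_succ]
    have e : ((k + 1 : ℕ) : ℝ) + ν + 1 = (k : ℝ) + (ν + 1) + 1 := by push_cast; ring
    rw [e]
    push_cast
    rw [mul_assoc, mul_div_mul_left _ _ (by positivity)]
  · intro k y hy
    have hp := gamma_add_pos hν k
    have hy' : |y| ≤ R := by simpa using (mem_ball_zero_iff.1 hy).le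
    rw [norm_div, norm_mul, norm_mul, norm_pow, Real.norm_eq_abs y, Real.norm_of_nonneg hp.le,
      Real.norm_of_nonneg (Nat.cast_nonneg _), Real.norm_of_nonneg (Nat.cast_nonneg _),
      div_mul_eq_div_div, div_eq_mul_inv _ (Real.Gamma _), mul_comm]
    exact mul_le_mul (h k) (by gcongr) (by positivity) hC

theorem continuous_besselSeries {ν : ℝ} (hν : -1 < ν) : Continuous (besselSeries ν) :=
  continuous_iff_continuousAt.2 fun w => (hasDerivAt_besselSeries hν w).continuousAt

/-- Coefficientwise, 1/Γ(k+ν+1) = (k + (ν+1))/Γ(k+ν+2). The part ν+1 gives order ν+1; the part k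
cancels against k! and, after a shift, gives order ν+2. -/
theorem besselSeries_recurrence {ν : ℝ} (hν : -1 < ν) (w : ℝ) :
    besselSeries ν w = (ν + 1) * besselSeries (ν + 1) w + w * besselSeries (ν + 2) w := by
  have h1 := summable_besselSeries (ν := ν + 1) (by linarith) w
  have h2 := summable_besselSeries (ν := ν + 2) (by linarith) w
  have h0 := summable_besselSeries hν w
  have hd : Summable fun k : ℕ => (k : ℝ) *
      (w ^ k / ((k.factorial : ℝ) * Real.Gamma ((k : ℝ) + (ν + 1) + 1))) := by
    refine (h0.sub (h1.mul_left (ν + 1))).congr fun k => ?_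
    have hp := gamma_add_pos hν k
    have e : (k : ℝ) + (ν + 1) + 1 = (k : ℝ) + ν + 2 := by ring
    have hn : (k : ℝ) + ν + 1 ≠ 0 := by
      have : (0 : ℝ) ≤ k := k.cast_nonneg
      linarith
    have : (k.factorial : ℝ) ≠ 0 := by positivity
    rw [e, gamma_succ_add hν k]
    field_simp
    ring
  have hd' : w * besselSeries (ν + 2) w = ∑' k : ℕ, (k : ℝ) *
      (w ^ k / ((k.factorial : ℝ) * Real.Gamma ((k : ℝ) + (ν + 1) + 1))) := by
    rw [hd.tsum_eq_zero_add, besselSeries, ← tsum_mul_left]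
    simp only [Nat.cast_zero, zero_mul, zero_add]
    refine tsum_congr fun k => ?_
    rw [Nat.factorial_succ]
    have : (k.factorial : ℝ) ≠ 0 := by positivity
    have e : ((k + 1 : ℕ) : ℝ) + (ν + 1) + 1 = (k : ℝ) + (ν + 2) + 1 := by push_cast; ring
    have hp := gamma_add_pos (ν := ν + 2) (by linarith) k
    rw [e]
    push_cast
    field_simp
    ring
  rw [hd', besselSeries, besselSeries, ← tsum_mul_left, ← (h1.mul_left _).tsum_add hd]
  refine tsum_congr fun k => ?_
  have hp := gamma_add_pos hν k
  have e : (k : ℝ) + (ν + 1) + 1 = (k : ℝ) + ν + 2 := by ring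
  have hn : (k : ℝ) + ν + 1 ≠ 0 := by
    have : (0 : ℝ) ≤ k := k.cast_nonneg
    linarith
  have : (k.factorial : ℝ) ≠ 0 := by positivity
  rw [e, gamma_succ_add hν k]
  field_simp
  ring

theorem besselI_eq_rpow_mul_besselSeries (ν : ℝ) {z : ℝ} (hz : 0 < z) :
    besselI ν z = (z / 2) ^ ν * besselSeries ν ((z / 2) ^ 2) := by
  rw [besselI, besselSeries, ← tsum_mul_left]
  refine tsum_congr fun k => ?_
  rw [Real.rpow_add (by positivity), Real.rpow_mul (by positivity), Real.rpow_natCast,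
    Real.rpow_ofNat]
  ring

theorem besselI_nonneg {ν : ℝ} (hν : -1 < ν) {z : ℝ} (hz : 0 < z) : 0 ≤ besselI ν z :=
  tsum_nonneg fun k => by
    have := gamma_add_pos hν k
    positivity

/-- Used twice: to extend the asymptotics down to orders above -1, and to eliminate order μ+2 from
the second derivative of the kernel. -/
theorem besselI_recurrence {ν : ℝ} (hν : -1 < ν) {z : ℝ} (hz : 0 < z) :
    besselI ν z = besselI (ν + 2) z + 2 * (ν + 1) / z * besselI (ν + 1) z := by
  rw [besselI_eq_rpow_mul_besselSeries _ hz, besselI_eq_rpow_mul_besselSeries _ hz,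
    besselI_eq_rpow_mul_besselSeries _ hz, besselSeries_recurrence hν,
    Real.rpow_add (by positivity), Real.rpow_add (by positivity), Real.rpow_one, Real.rpow_ofNat]
  field_simp
  ring

/-! ### Poisson's integral representation -/

/-- Euler's Beta integral, read off from the normalisation of the Beta density. -/
theorem integral_rpow_mul_one_sub_rpow {a b : ℝ} (ha : 0 < a) (hb : 0 < b) :
    ∫ r in Ioo (0 : ℝ) 1, r ^ (a - 1) * (1 - r) ^ (b - 1) =
      Real.Gamma a * Real.Gamma b / Real.Gamma (a + b) := by
  have h := ProbabilityTheory.lintegral_betaPDF_eq_one ha hb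
  rw [ProbabilityTheory.lintegral_betaPDF] at h
  have hp := ProbabilityTheory.beta_pos ha hb
  have h2 : ∫ r in Ioo (0 : ℝ) 1, 1 / ProbabilityTheory.beta a b * r ^ (a - 1) *
      (1 - r) ^ (b - 1) = 1 := by
    rw [integral_eq_lintegral_of_nonneg_ae, h]
    · simp
    · refine (ae_restrict_iff' measurableSet_Ioo).2 (Eventually.of_forall fun r hr => ?_)
      have h0 := hr.1
      have h1 : 0 ≤ 1 - r := by linarith [hr.2]
      have := Real.rpow_nonneg h1 (b - 1)
      simp only [Pi.zero_apply]
      positivity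
    · exact (by fun_prop : Measurable _).aestronglyMeasurable
  simp_rw [mul_assoc] at h2
  rw [integral_const_mul] at h2
  change _ = ProbabilityTheory.beta a b
  field_simp at h2
  linarith

/-- Even moments of the weight `(1-s²)^(μ-1/2)`. -/
theorem integral_even_moment {μ : ℝ} (hμ : -(1 / 2) < μ) (k : ℕ) :
    ∫ s in Ioo (0 : ℝ) 1, 2 * s ^ (2 * k) * (1 - s ^ 2) ^ (μ - 1 / 2) =
      Real.Gamma ((k : ℝ) + 1 / 2) * Real.Gamma (μ + 1 / 2) / Real.Gamma ((k : ℝ) + μ + 1) := by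
  have hk : (0 : ℝ) ≤ k := k.cast_nonneg
  have h := integral_rpow_mul_one_sub_rpow (a := (k : ℝ) + 1 / 2) (b := μ + 1 / 2)
    (by linarith) (by linarith)
  have e : (k : ℝ) + 1 / 2 + (μ + 1 / 2) = (k : ℝ) + μ + 1 := by ring
  rw [e] at h
  -- Indicators carry the integrals to (0,∞), where the substitution r = s² is made.
  have hI : ∀ g : ℝ → ℝ, ∫ s in Ioo (0 : ℝ) 1, g s =
      ∫ s in Ioi (0 : ℝ), (Ioo (0 : ℝ) 1).indicator g s := fun g => by
    rw [setIntegral_indicator measurableSet_Ioo, inter_eq_self_of_subset_right Ioo_subset_Ioi_self]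
  rw [← h, hI, hI, ← integral_comp_rpow_Ioi_of_pos (p := 2) (g := (Ioo (0 : ℝ) 1).indicator
    fun r => r ^ ((k : ℝ) + 1 / 2 - 1) * (1 - r) ^ (μ + 1 / 2 - 1)) two_pos]
  refine setIntegral_congr_fun measurableSet_Ioi fun s (hs : 0 < s) => ?_
  have hiff : s ^ (2 : ℝ) ∈ Ioo (0 : ℝ) 1 ↔ s ∈ Ioo (0 : ℝ) 1 := by
    rw [Real.rpow_two]
    constructor
    · rintro ⟨h1, h2⟩
      exact ⟨hs, by nlinarith⟩
    · rintro ⟨h1, h2⟩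
      exact ⟨by positivity, by nlinarith⟩
  by_cases hs1 : s ∈ Ioo (0 : ℝ) 1
  · simp only [indicator_of_mem hs1, indicator_of_mem (hiff.2 hs1), smul_eq_mul]
    have e1 : (2 : ℝ) - 1 = 1 := by norm_num
    have e2 : s * (s ^ (2 : ℝ)) ^ ((k : ℝ) + 1 / 2 - 1) = s ^ (2 * k) := by
      rw [← Real.rpow_mul hs.le, ← Real.rpow_natCast s (2 * k)]
      nth_rewrite 1 [← Real.rpow_one s]
      rw [← Real.rpow_add hs]
      congr 1
      push_cast
      ring
    have e3 : μ + 1 / 2 - 1 = μ - 1 / 2 := by ring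
    rw [e1, Real.rpow_one, e3, ← e2, Real.rpow_two]
    ring
  · simp only [indicator_of_notMem hs1, indicator_of_notMem (fun h' => hs1 (hiff.1 h')),
      smul_zero]

/-- A non-integrable function has Bochner integral 0, whereas the computed moment is positive. -/
theorem integrableOn_even_moment {μ : ℝ} (hμ : -(1 / 2) < μ) (k : ℕ) :
    IntegrableOn (fun s : ℝ => 2 * s ^ (2 * k) * (1 - s ^ 2) ^ (μ - 1 / 2)) (Ioo 0 1) := by
  by_contra hc
  have h := integral_even_moment hμ k
  rw [integral_undef hc] at h
  have hk : (0 : ℝ) ≤ k := k.cast_nonneg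
  have h1 := Real.Gamma_pos_of_pos (s := (k : ℝ) + 1 / 2) (by linarith)
  have h2 := Real.Gamma_pos_of_pos (s := μ + 1 / 2) (by linarith)
  have h3 := gamma_add_pos (ν := μ) (by linarith) k
  have : 0 < Real.Gamma ((k : ℝ) + 1 / 2) * Real.Gamma (μ + 1 / 2) /
    Real.Gamma ((k : ℝ) + μ + 1) := by positivity
  linarith

/-- Legendre's duplication formula at k + 1/2. It matches the moments of the weight with the
factorials (2k)! of the cosh series. -/
theorem gamma_nat_add_half_mul_factorial (k : ℕ) :
    Real.Gamma ((k : ℝ) + 1 / 2) * (k.factorial : ℝ) =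
      ((2 * k).factorial : ℝ) * Real.sqrt Real.pi / 4 ^ k := by
  have h := Real.Gamma_mul_Gamma_add_half ((k : ℝ) + 1 / 2)
  have e1 : (k : ℝ) + 1 / 2 + 1 / 2 = k + 1 := by ring
  have e2 : 2 * ((k : ℝ) + 1 / 2) = ((2 * k : ℕ) : ℝ) + 1 := by push_cast; ring
  have e3 : (1 : ℝ) - (((2 * k : ℕ) : ℝ) + 1) = -((2 * k : ℕ) : ℝ) := by ring
  rw [e1, e2, e3, Real.Gamma_nat_eq_factorial, Real.Gamma_nat_eq_factorial,
    Real.rpow_neg two_pos.le, Real.rpow_natCast, pow_mul] at h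
  rw [h]
  norm_num
  ring

/-- The cosh series is integrated term by term; since s^{2k} ≤ 1, the terms are dominated by
z^{2k}/(2k)! times the weight. -/
theorem hasSum_poisson {μ : ℝ} (hμ : -(1 / 2) < μ) (z : ℝ) :
    HasSum (fun k : ℕ => ∫ s in Ioo (0 : ℝ) 1,
        z ^ (2 * k) / ((2 * k).factorial : ℝ) * (2 * s ^ (2 * k) * (1 - s ^ 2) ^ (μ - 1 / 2)))
      (∫ s in Ioo (0 : ℝ) 1, 2 * Real.cosh (z * s) * (1 - s ^ 2) ^ (μ - 1 / 2)) := by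
  have hw : ∀ s ∈ Ioo (0 : ℝ) 1, 0 ≤ (1 - s ^ 2) ^ (μ - 1 / 2) := fun s hs =>
    Real.rpow_nonneg (by nlinarith [hs.1, hs.2]) _
  have hint := integrableOn_even_moment hμ 0
  refine hasSum_integral_of_dominated_convergence
    (fun k s => z ^ (2 * k) / ((2 * k).factorial : ℝ) *
      (2 * s ^ (2 * 0) * (1 - s ^ 2) ^ (μ - 1 / 2)))
    (fun k => ((integrableOn_even_moment hμ k).const_mul _).aestronglyMeasurable) ?_ ?_ ?_ ?_
  · intro k
    refine (ae_restrict_iff' measurableSet_Ioo).2 (Eventually.of_forall fun s hs => ?_)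
    have h1 : s ^ (2 * k) ≤ 1 := pow_le_one₀ hs.1.le hs.2.le
    have h2 := hw s hs
    have h0 := hs.1
    have h3 : 0 ≤ z ^ (2 * k) := (even_two_mul k).pow_nonneg z
    rw [Real.norm_of_nonneg (by positivity)]
    have : 2 * s ^ (2 * k) * (1 - s ^ 2) ^ (μ - 1 / 2) ≤
        2 * s ^ (2 * 0) * (1 - s ^ 2) ^ (μ - 1 / 2) := by
      rw [mul_zero, pow_zero]
      gcongr
    gcongr
  · exact Eventually.of_forall fun s => (Real.hasSum_cosh z).summable.mul_right _
  · simp_rw [tsum_mul_right]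
    exact hint.const_mul _
  · refine Eventually.of_forall fun s => ?_
    have h := ((Real.hasSum_cosh (z * s)).mul_left 2).mul_right ((1 - s ^ 2) ^ (μ - 1 / 2))
    refine h.congr_fun fun k => ?_
    rw [mul_pow]
    ring

/-- Poisson's integral representation of `I_μ`, for `μ > -1/2`. -/
theorem besselI_eq_poisson {μ : ℝ} (hμ : -(1 / 2) < μ) {z : ℝ} (hz : 0 < z) :
    besselI μ z = (z / 2) ^ μ / (Real.sqrt Real.pi * Real.Gamma (μ + 1 / 2)) *
      ∫ s in Ioo (0 : ℝ) 1, 2 * Real.cosh (z * s) * (1 - s ^ 2) ^ (μ - 1 / 2) := by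
  rw [← (hasSum_poisson hμ z).tsum_eq, ← tsum_mul_left, besselI]
  refine tsum_congr fun k => ?_
  rw [integral_const_mul, integral_even_moment hμ k]
  have h := gamma_nat_add_half_mul_factorial k
  have h2 := Real.Gamma_pos_of_pos (s := μ + 1 / 2) (by linarith)
  have h3 := gamma_add_pos (ν := μ) (by linarith) k
  have h4 : (k.factorial : ℝ) ≠ 0 := by positivity
  have h5 : ((2 * k).factorial : ℝ) ≠ 0 := by positivity
  have h6 : Real.sqrt Real.pi ≠ 0 := by positivity
  have h7 : Real.Gamma ((k : ℝ) + 1 / 2) =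
      ((2 * k).factorial : ℝ) * Real.sqrt Real.pi / 4 ^ k / k.factorial := by
    rw [← h]; field_simp
  have h8 : (z / 2) ^ (2 * (k : ℝ) + μ) = z ^ (2 * k) / 4 ^ k * (z / 2) ^ μ := by
    rw [Real.rpow_add (by positivity), Real.rpow_mul (by positivity), Real.rpow_natCast,
      Real.rpow_two, div_pow, div_pow, pow_mul]
    norm_num
  rw [h7, h8]
  generalize Real.Gamma (μ + 1 / 2) = G at h2
  field_simp

/-! ### Asymptotics of the Bessel function at infinity -/

/-- The mass concentrates at s = 1 on the scale 1/z. With w = z(1-s) one has 1-s² = (w/z)(2-w/z),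
and the prefactor absorbs the powers of z. -/
theorem integral_laplace_rescale (ν : ℝ) {z : ℝ} (hz : 0 < z) :
    z ^ (ν + 1) * ∫ s in Ioo (0 : ℝ) 1, Real.exp (-z) * Real.exp (z * s) * (1 - s ^ 2) ^ ν =
      ∫ w in Ioi (0 : ℝ), (Iio z).indicator
        (fun w => Real.exp (-w) * w ^ ν * (2 - w / z) ^ ν) w := by
  let g : ℝ → ℝ := fun w => Real.exp (-w) * ((w / z) * (2 - w / z)) ^ ν
  have e1 : ∫ s in Ioo (0 : ℝ) 1, Real.exp (-z) * Real.exp (z * s) * (1 - s ^ 2) ^ ν =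
      ∫ s in (0 : ℝ)..1, g (z * (1 - s)) := by
    rw [intervalIntegral.integral_of_le zero_le_one, integral_Ioc_eq_integral_Ioo]
    refine setIntegral_congr_fun measurableSet_Ioo fun s _ => ?_
    simp only [g]
    rw [← Real.exp_add, mul_div_cancel_left₀ _ hz.ne']
    congr 2 <;> ring
  rw [e1, intervalIntegral.integral_comp_sub_left (fun r => g (z * r)) 1,
    intervalIntegral.integral_comp_mul_left g hz.ne']
  simp only [sub_self, mul_zero, sub_zero, mul_one, smul_eq_mul]
  rw [intervalIntegral.integral_of_le hz.le, integral_Ioc_eq_integral_Ioo,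
    setIntegral_indicator measurableSet_Iio, Ioi_inter_Iio, ← mul_assoc,
    ← integral_const_mul]
  refine setIntegral_congr_fun measurableSet_Ioo fun w hw => ?_
  have h0 : 0 < w := hw.1
  have h1 : 0 ≤ 2 - w / z := by
    have : w / z < 1 := (div_lt_one hz).2 hw.2
    linarith
  simp only [g]
  rw [Real.mul_rpow (by positivity) h1, Real.div_rpow h0.le hz.le, Real.rpow_add hz, Real.rpow_one]
  have := (Real.rpow_pos_of_pos hz ν).ne'
  field_simp

theorem tendsto_integral_laplace {ν : ℝ} (hν : -1 < ν) :
    Tendsto (fun z : ℝ => ∫ w in Ioi (0 : ℝ), (Iio z).indicator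
        (fun w => Real.exp (-w) * w ^ ν * (2 - w / z) ^ ν) w)
      atTop (𝓝 (2 ^ ν * Real.Gamma (ν + 1))) := by
  have hG : IntegrableOn (fun w : ℝ => Real.exp (-w) * w ^ ν) (Ioi 0) := by
    simpa using Real.GammaIntegral_convergent (s := ν + 1) (by linarith)
  have hlim : (2 : ℝ) ^ ν * Real.Gamma (ν + 1) =
      ∫ w in Ioi (0 : ℝ), Real.exp (-w) * w ^ ν * 2 ^ ν := by
    rw [integral_mul_const, Real.Gamma_eq_integral (by linarith), mul_comm]
    simp
  rw [hlim]
  refine tendsto_integral_filter_of_dominated_convergence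
    (fun w => Real.exp (-w) * w ^ ν * (1 + 2 ^ ν)) ?_ ?_ (hG.mul_const _) ?_
  · refine Eventually.of_forall fun z => ?_
    exact (Measurable.indicator (by fun_prop) measurableSet_Iio).aestronglyMeasurable
  · filter_upwards [eventually_gt_atTop 0] with z hz
    refine (ae_restrict_iff' measurableSet_Ioi).2 (Eventually.of_forall fun w (hw : 0 < w) => ?_)
    by_cases hwz : w ∈ Iio z
    · rw [indicator_of_mem hwz]
      have hq : w / z < 1 := (div_lt_one hz).2 hwz
      have hq0 : 0 < w / z := by positivity
      -- For w < z the base lies in [1,2], so this covers both signs of ν.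
      have h1 : (2 - w / z) ^ ν ≤ 1 + 2 ^ ν := by
        rcases le_total 0 ν with h | h
        · have : (2 - w / z) ^ ν ≤ 2 ^ ν := Real.rpow_le_rpow (by linarith) (by linarith) h
          linarith
        · have : (2 - w / z) ^ ν ≤ 1 := Real.rpow_le_one_of_one_le_of_nonpos (by linarith) h
          have : (0 : ℝ) < 2 ^ ν := by positivity
          linarith
      have h2 : 0 ≤ (2 - w / z) ^ ν := Real.rpow_nonneg (by linarith) _
      rw [Real.norm_of_nonneg (by positivity)]
      gcongr
    · rw [indicator_of_notMem hwz, norm_zero]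
      positivity
  · refine (ae_restrict_iff' measurableSet_Ioi).2 (Eventually.of_forall fun w (hw : 0 < w) => ?_)
    have h1 : Tendsto (fun z : ℝ => 2 - w / z) atTop (𝓝 (2 - 0)) :=
      tendsto_const_nhds.sub (tendsto_const_nhds.div_atTop tendsto_id)
    rw [sub_zero] at h1
    have h2 := (h1.rpow_const (p := ν) (Or.inl two_ne_zero)).const_mul (Real.exp (-w) * w ^ ν)
    refine h2.congr' ?_
    filter_upwards [eventually_gt_atTop w] with z hz
    rw [indicator_of_mem (mem_Iio.2 hz)]

/-- `√z e^{-z} I_ν(z)`. -/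
noncomputable def besselIScaled (ν z : ℝ) : ℝ := Real.sqrt z * Real.exp (-z) * besselI ν z

/-- In Poisson's formula 2cosh(zs) = e^{zs} + e^{-zs}. The first exponential yields the Laplace
limit, the second an exponentially small term. -/
theorem tendsto_besselIScaled_of_neg_half_lt {μ : ℝ} (hμ : -(1 / 2) < μ) :
    Tendsto (besselIScaled μ) atTop (𝓝 (Real.sqrt (2 * Real.pi))⁻¹) := by
  set ν := μ - 1 / 2 with hνdef
  have hν : -1 < ν := by linarith
  have hG := Real.Gamma_pos_of_pos (s := ν + 1) (by linarith)
  have hw : ∀ s ∈ Ioo (0 : ℝ) 1, 0 ≤ (1 - s ^ 2) ^ ν := fun s hs =>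
    Real.rpow_nonneg (by nlinarith [hs.1, hs.2]) _
  have hint := integrableOn_even_moment hμ 0
  simp only [mul_zero, pow_zero, mul_one] at hint
  set M := ∫ s in Ioo (0 : ℝ) 1, 2 * (1 - s ^ 2) ^ ν with hM
  have hI1 : ∀ z : ℝ, 0 < z → IntegrableOn
      (fun s => Real.exp (-z) * Real.exp (z * s) * (1 - s ^ 2) ^ ν) (Ioo 0 1) := by
    intro z hz
    refine Integrable.mono' hint (by fun_prop : Measurable _).aestronglyMeasurable
      ((ae_restrict_iff' measurableSet_Ioo).2 (Eventually.of_forall fun s hs => ?_))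
    have h2 := hw s hs
    rw [Real.norm_of_nonneg (by positivity), ← Real.exp_add]
    have : Real.exp (-z + z * s) ≤ 2 :=
      (Real.exp_le_one_iff.2 (by nlinarith [hs.2])).trans one_le_two
    gcongr
  have hI2 : ∀ z : ℝ, 0 < z → IntegrableOn
      (fun s => Real.exp (-z) * Real.exp (-(z * s)) * (1 - s ^ 2) ^ ν) (Ioo 0 1) := by
    intro z hz
    refine Integrable.mono' hint (by fun_prop : Measurable _).aestronglyMeasurable
      ((ae_restrict_iff' measurableSet_Ioo).2 (Eventually.of_forall fun s hs => ?_))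
    have h2 := hw s hs
    rw [Real.norm_of_nonneg (by positivity), ← Real.exp_add]
    have : Real.exp (-z + -(z * s)) ≤ 2 :=
      (Real.exp_le_one_iff.2 (by nlinarith [hs.1])).trans one_le_two
    gcongr
  have hsmall : Tendsto (fun z : ℝ => z ^ (ν + 1) *
      ∫ s in Ioo (0 : ℝ) 1, Real.exp (-z) * Real.exp (-(z * s)) * (1 - s ^ 2) ^ ν)
      atTop (𝓝 0) := by
    have h0 := (tendsto_rpow_mul_exp_neg_mul_atTop_nhds_zero (ν + 1) 1 one_pos).mul_const M
    rw [zero_mul] at h0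
    refine squeeze_zero' ?_ ?_ h0
    · filter_upwards [eventually_gt_atTop 0] with z hz
      refine mul_nonneg (Real.rpow_nonneg hz.le _) (setIntegral_nonneg measurableSet_Ioo
        fun s hs => ?_)
      have := hw s hs
      positivity
    · filter_upwards [eventually_gt_atTop 0] with z hz
      rw [mul_assoc, hM, ← integral_const_mul (Real.exp (-1 * z))]
      refine mul_le_mul_of_nonneg_left ?_ (Real.rpow_nonneg hz.le _)
      refine setIntegral_mono_on (hI2 z hz) (hint.const_mul _) measurableSet_Ioo fun s hs => ?_
      have h2 := hw s hs
      have : Real.exp (-(z * s)) ≤ 2 :=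
        (Real.exp_le_one_iff.2 (by nlinarith [hs.1])).trans one_le_two
      rw [neg_one_mul, mul_assoc]
      gcongr
  have hmain := ((tendsto_integral_laplace hν).add hsmall).const_mul
    (1 / 2 ^ μ / (Real.sqrt Real.pi * Real.Gamma (μ + 1 / 2)))
  have hc : 1 / 2 ^ μ / (Real.sqrt Real.pi * Real.Gamma (μ + 1 / 2)) *
      (2 ^ ν * Real.Gamma (ν + 1) + 0) = (Real.sqrt (2 * Real.pi))⁻¹ := by
    have e : μ + 1 / 2 = ν + 1 := by rw [hνdef]; ring
    have e2 : (2 : ℝ) ^ ν = 2 ^ μ / Real.sqrt 2 := by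
      rw [hνdef, Real.rpow_sub two_pos, Real.sqrt_eq_rpow]
    rw [e, e2, Real.sqrt_mul two_pos.le]
    field_simp
    simp
  rw [hc] at hmain
  refine hmain.congr' ?_
  filter_upwards [eventually_gt_atTop 0] with z hz
  rw [← integral_laplace_rescale ν hz, ← mul_add, ← integral_add (hI1 z hz) (hI2 z hz),
    besselIScaled, besselI_eq_poisson hμ hz]
  have e3 : ∀ s : ℝ, Real.exp (-z) * Real.exp (z * s) * (1 - s ^ 2) ^ ν +
      Real.exp (-z) * Real.exp (-(z * s)) * (1 - s ^ 2) ^ ν =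
      Real.exp (-z) * (2 * Real.cosh (z * s) * (1 - s ^ 2) ^ ν) := by
    intro s
    rw [Real.cosh_eq]
    ring
  simp_rw [e3]
  rw [integral_const_mul]
  have e4 : z ^ (ν + 1) = z ^ μ * Real.sqrt z := by
    rw [Real.sqrt_eq_rpow, ← Real.rpow_add hz, hνdef]
    congr 1
    ring
  rw [e4, Real.div_rpow hz.le two_pos.le]
  ring

/-- By the recurrence, order μ behaves like order μ+2, the order μ+1 term carrying a factor O(1/z).
Both orders exceed -1/2. -/
theorem tendsto_besselIScaled {μ : ℝ} (hμ : -1 < μ) :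
    Tendsto (besselIScaled μ) atTop (𝓝 (Real.sqrt (2 * Real.pi))⁻¹) := by
  have h1 := tendsto_besselIScaled_of_neg_half_lt (μ := μ + 1) (by linarith)
  have h2 := tendsto_besselIScaled_of_neg_half_lt (μ := μ + 2) (by linarith)
  have h3 : Tendsto (fun z : ℝ => 2 * (μ + 1) / z) atTop (𝓝 0) :=
    tendsto_const_nhds.div_atTop tendsto_id
  have h := h2.add (h3.mul h1)
  rw [zero_mul, add_zero] at h
  refine h.congr' ?_
  filter_upwards [eventually_gt_atTop 0] with z hz
  rw [besselIScaled, besselIScaled, besselIScaled, besselI_recurrence hμ hz]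
  ring

theorem continuousOn_besselI {ν : ℝ} (hν : -1 < ν) : ContinuousOn (besselI ν) (Ioi 0) := by
  have h : ContinuousOn (fun z : ℝ => (z / 2) ^ ν * besselSeries ν ((z / 2) ^ 2)) (Ioi 0) := by
    refine ContinuousOn.mul ?_ ((continuous_besselSeries hν).comp (by fun_prop)).continuousOn
    exact ContinuousOn.rpow_const (by fun_prop) fun z (hz : 0 < z) => Or.inl (by positivity)
  exact h.congr fun z hz => besselI_eq_rpow_mul_besselSeries ν hz

/-- Convergence at infinity controls large z and continuity controls the remaining compact interval.
A positive z₀ is needed because the function blows up at 0 when ν < -1/2. -/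
theorem exists_besselIScaled_le {ν : ℝ} (hν : -1 < ν) {z₀ : ℝ} (hz₀ : 0 < z₀) :
    ∃ C : ℝ, 0 < C ∧ ∀ z, z₀ ≤ z → besselIScaled ν z ≤ C := by
  have h := (tendsto_besselIScaled hν).eventually
    (eventually_le_nhds (b := (Real.sqrt (2 * Real.pi))⁻¹ + 1) (by linarith))
  obtain ⟨R, hR⟩ := eventually_atTop.1 h
  have hc : ContinuousOn (besselIScaled ν) (Icc z₀ R) :=
    ContinuousOn.mul (by fun_prop)
      ((continuousOn_besselI hν).mono fun z hz => hz₀.trans_le hz.1)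
  obtain ⟨C, hC⟩ := (isCompact_Icc.bddAbove_image hc)
  have hp : (0 : ℝ) ≤ (Real.sqrt (2 * Real.pi))⁻¹ := by positivity
  refine ⟨|C| + ((Real.sqrt (2 * Real.pi))⁻¹ + 1), by positivity, fun z hz => ?_⟩
  rcases le_total R z with h1 | h1
  · linarith [hR z h1, abs_nonneg C]
  · have := hC (mem_image_of_mem _ (show z ∈ Icc z₀ R from ⟨hz, h1⟩))
    linarith [le_abs_self C]

/-! ### Derivatives of the kernel and the heat equation -/

/-- Each factor here is a power, an exponential or the entire series, so the derivatives in τ and x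
follow from the product rule. -/
theorem besselHeatKernel_eq_series (μ : ℝ) {τ x y : ℝ} (hτ : 0 < τ) (hx : 0 < x) (hy : 0 < y) :
    besselHeatKernel μ τ x y = 4 ^ (-μ) / 2 * y ^ (μ + 1 / 2) * (x ^ (μ + 1 / 2) *
      τ ^ (-(μ + 1)) * besselSeries μ ((x * y / (4 * τ)) ^ 2) *
      Real.exp (-(x ^ 2 + y ^ 2) / (4 * τ))) := by
  have e : x * y / (2 * τ) / 2 = x * y / (4 * τ) := by field_simp; norm_num
  rw [besselHeatKernel, besselI_eq_rpow_mul_besselSeries _ (by positivity), e,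
    Real.div_rpow (by positivity) (by positivity), Real.mul_rpow hx.le hy.le,
    Real.mul_rpow (by positivity) hτ.le, Real.sqrt_eq_rpow, Real.mul_rpow hx.le hy.le,
    Real.rpow_add hx, Real.rpow_add hy, neg_add μ 1, Real.rpow_add hτ, Real.rpow_neg hτ.le,
    Real.rpow_neg_one, Real.rpow_neg (by positivity)]
  field_simp

/-- The prefactor is kept as for order μ, so that a term containing the derivative of the series is
recognised as the kernel of order μ+1. -/
theorem besselHeatKernel_succ_eq_series (μ : ℝ) {τ x y : ℝ} (hτ : 0 < τ) (hx : 0 < x)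
    (hy : 0 < y) :
    besselHeatKernel (μ + 1) τ x y = 4 ^ (-μ) / 2 * y ^ (μ + 1 / 2) * (x ^ (μ + 1 / 2) *
      τ ^ (-(μ + 1)) * besselSeries (μ + 1) ((x * y / (4 * τ)) ^ 2) *
      Real.exp (-(x ^ 2 + y ^ 2) / (4 * τ))) * (x * y / (4 * τ)) := by
  have e : μ + 1 + 1 / 2 = (μ + 1 / 2) + 1 := by ring
  have e1 : -(μ + 1 + 1) = -(μ + 1) - 1 := by ring
  have e2 : -(μ + 1) = -μ - 1 := by ring
  rw [besselHeatKernel_eq_series _ hτ hx hy, e, e1, Real.rpow_add_one hx.ne',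
    Real.rpow_add_one hy.ne', Real.rpow_sub_one hτ.ne']
  nth_rewrite 1 [e2]
  rw [Real.rpow_sub_one four_ne_zero]
  field_simp

theorem besselHeatKernel_recurrence {μ : ℝ} (hμ : -1 < μ) {τ x y : ℝ} (hτ : 0 < τ) (hx : 0 < x)
    (hy : 0 < y) :
    besselHeatKernel (μ + 1 + 1) τ x y =
      besselHeatKernel μ τ x y - (μ + 1) * (4 * τ / (x * y)) * besselHeatKernel (μ + 1) τ x y := by
  have e : x * y / (2 * τ) ≠ 0 := by positivity
  have h := besselI_recurrence hμ (z := x * y / (2 * τ)) (by positivity)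
  have e2 : μ + 1 + 1 = μ + 2 := by ring
  rw [besselHeatKernel, besselHeatKernel, besselHeatKernel, h, e2]
  field_simp
  ring

/-- `∂W/∂τ` in terms of the kernels of orders `μ` and `μ + 1`. -/
theorem hasDerivAt_besselHeatKernel_time {μ : ℝ} (hμ : -1 < μ) {τ x y : ℝ} (hτ : 0 < τ)
    (hx : 0 < x) (hy : 0 < y) :
    HasDerivAt (fun s => besselHeatKernel μ s x y)
      ((-(μ + 1) / τ + (x ^ 2 + y ^ 2) / (4 * τ ^ 2)) * besselHeatKernel μ τ x y -
        x * y / (2 * τ ^ 2) * besselHeatKernel (μ + 1) τ x y) τ := by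
  have h1 : HasDerivAt (fun s : ℝ => s ^ (-(μ + 1))) (-(μ + 1) * τ ^ (-(μ + 1) - 1)) τ :=
    Real.hasDerivAt_rpow_const (Or.inl hτ.ne')
  have h2 : HasDerivAt (fun s : ℝ => (x * y / (4 * s)) ^ 2)
      (-2 * (x * y / (4 * τ)) ^ 2 / τ) τ := by
    have := (((hasDerivAt_const τ (x * y)).div ((hasDerivAt_id τ).const_mul 4)
      (by simpa using hτ.ne')).pow 2)
    refine this.congr_deriv ?_
    simp only [id, Pi.div_apply, Nat.add_one_sub_one, pow_one]
    push_cast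
    field_simp
    ring
  have h3 := (hasDerivAt_besselSeries hμ ((x * y / (4 * τ)) ^ 2)).comp τ h2
  have h4 : HasDerivAt (fun s : ℝ => Real.exp (-(x ^ 2 + y ^ 2) / (4 * s)))
      (Real.exp (-(x ^ 2 + y ^ 2) / (4 * τ)) * ((x ^ 2 + y ^ 2) / (4 * τ ^ 2))) τ := by
    refine (((hasDerivAt_const τ (-(x ^ 2 + y ^ 2))).div ((hasDerivAt_id τ).const_mul 4)
      (by simpa using hτ.ne')).exp).congr_deriv ?_
    simp only [id, Pi.div_apply]
    field_simp
    ring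
  have h := ((((h1.const_mul (x ^ (μ + 1 / 2))).mul h3).mul h4).const_mul
    (4 ^ (-μ) / 2 * y ^ (μ + 1 / 2)))
  refine (h.congr_of_eventuallyEq ?_).congr_deriv ?_
  · filter_upwards [lt_mem_nhds hτ] with s hs
    exact besselHeatKernel_eq_series μ hs hx hy
  · rw [besselHeatKernel_eq_series μ hτ hx hy, besselHeatKernel_succ_eq_series μ hτ hx hy,
      Real.rpow_sub_one hτ.ne']
    simp only [Function.comp, Pi.mul_apply]
    -- With the transcendental factors as free symbols, the identity is one of rational functions.
    generalize besselSeries μ _ = F0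
    generalize besselSeries (μ + 1) _ = F1
    generalize Real.exp _ = E
    generalize x ^ (μ + 1 / 2) = X
    generalize y ^ (μ + 1 / 2) = Y
    generalize τ ^ (-(μ + 1)) = S
    field_simp
    ring

/-- `∂W/∂x` in terms of the kernels of orders `μ` and `μ + 1`. -/
theorem hasDerivAt_besselHeatKernel_space {μ : ℝ} (hμ : -1 < μ) {τ x y : ℝ} (hτ : 0 < τ)
    (hx : 0 < x) (hy : 0 < y) :
    HasDerivAt (fun z => besselHeatKernel μ τ z y)
      (((μ + 1 / 2) / x - x / (2 * τ)) * besselHeatKernel μ τ x y +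
        y / (2 * τ) * besselHeatKernel (μ + 1) τ x y) x := by
  have h1 : HasDerivAt (fun s : ℝ => s ^ (μ + 1 / 2)) ((μ + 1 / 2) * x ^ (μ + 1 / 2 - 1)) x :=
    Real.hasDerivAt_rpow_const (Or.inl hx.ne')
  have h2 : HasDerivAt (fun s : ℝ => (s * y / (4 * τ)) ^ 2)
      (2 * (x * y / (4 * τ)) ^ 2 / x) x := by
    refine ((((hasDerivAt_id x).mul_const y).div_const (4 * τ)).pow 2).congr_deriv ?_
    simp only [id, Nat.add_one_sub_one, pow_one]
    push_cast
    field_simp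
  have h3 := (hasDerivAt_besselSeries hμ ((x * y / (4 * τ)) ^ 2)).comp x h2
  have h4 : HasDerivAt (fun s : ℝ => Real.exp (-(s ^ 2 + y ^ 2) / (4 * τ)))
      (Real.exp (-(x ^ 2 + y ^ 2) / (4 * τ)) * (-x / (2 * τ))) x := by
    refine ((((hasDerivAt_pow 2 x).add_const (y ^ 2)).neg.div_const (4 * τ)).exp).congr_deriv ?_
    simp only [Pi.neg_apply]
    field_simp
    ring
  have h := ((((h1.mul_const (τ ^ (-(μ + 1)))).mul h3).mul h4).const_mul
    (4 ^ (-μ) / 2 * y ^ (μ + 1 / 2)))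
  refine (h.congr_of_eventuallyEq ?_).congr_deriv ?_
  · filter_upwards [lt_mem_nhds hx] with s hs
    exact besselHeatKernel_eq_series μ hτ hs hy
  · rw [besselHeatKernel_eq_series μ hτ hx hy, besselHeatKernel_succ_eq_series μ hτ hx hy,
      Real.rpow_sub_one hx.ne']
    simp only [Function.comp, Pi.mul_apply]
    generalize besselSeries μ _ = F0
    generalize besselSeries (μ + 1) _ = F1
    generalize Real.exp _ = E
    generalize x ^ (μ + 1 / 2) = X
    generalize y ^ (μ + 1 / 2) = Y
    generalize τ ^ (-(μ + 1)) = S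
    field_simp
    ring

theorem besselHeatKernelDt_eq {μ : ℝ} (hμ : -1 < μ) {τ x y : ℝ} (hτ : 0 < τ)
    (hx : 0 < x) (hy : 0 < y) :
    besselHeatKernelDt μ τ x y =
      (-(μ + 1) / τ + (x ^ 2 + y ^ 2) / (4 * τ ^ 2)) * besselHeatKernel μ τ x y -
        x * y / (2 * τ ^ 2) * besselHeatKernel (μ + 1) τ x y :=
  (hasDerivAt_besselHeatKernel_time hμ hτ hx hy).deriv

/-- `∂W/∂x`. -/
noncomputable def besselHeatKernelDx (μ τ x y : ℝ) : ℝ :=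
  ((μ + 1 / 2) / x - x / (2 * τ)) * besselHeatKernel μ τ x y +
    y / (2 * τ) * besselHeatKernel (μ + 1) τ x y

/-- The heat equation `∂²W/∂x² = ∂W/∂τ - (1/4 - μ²) x⁻² W`. -/
theorem hasDerivAt_besselHeatKernelDx {μ : ℝ} (hμ : -1 < μ) {τ x y : ℝ} (hτ : 0 < τ)
    (hx : 0 < x) (hy : 0 < y) :
    HasDerivAt (fun z => besselHeatKernelDx μ τ z y)
      (besselHeatKernelDt μ τ x y - (1 / 4 - μ ^ 2) / x ^ 2 * besselHeatKernel μ τ x y) x := by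
  have h0 := hasDerivAt_besselHeatKernel_space hμ hτ hx hy
  have h1 := hasDerivAt_besselHeatKernel_space (μ := μ + 1) (by linarith) hτ hx hy
  have h2 : HasDerivAt (fun z : ℝ => (μ + 1 / 2) / z - z / (2 * τ))
      (-(μ + 1 / 2) / x ^ 2 - 1 / (2 * τ)) x := by
    refine (((hasDerivAt_const x (μ + 1 / 2)).div (hasDerivAt_id x) hx.ne').sub
      ((hasDerivAt_id x).div_const (2 * τ))).congr_deriv ?_
    simp
  refine ((h2.mul h0).add (h1.const_mul (y / (2 * τ)))).congr_deriv ?_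
  rw [besselHeatKernel_recurrence hμ hτ hx hy, besselHeatKernelDt_eq hμ hτ hx hy]
  field_simp
  ring

theorem besselHeatKernelDxx_eq {μ : ℝ} (hμ : -1 < μ) {τ x y : ℝ} (hτ : 0 < τ)
    (hx : 0 < x) (hy : 0 < y) :
    besselHeatKernelDxx μ τ x y =
      besselHeatKernelDt μ τ x y - (1 / 4 - μ ^ 2) / x ^ 2 * besselHeatKernel μ τ x y := by
  rw [besselHeatKernelDxx, ← (hasDerivAt_besselHeatKernelDx hμ hτ hx hy).deriv]
  refine Filter.EventuallyEq.deriv_eq ?_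
  filter_upwards [lt_mem_nhds hx] with z hz
  exact (hasDerivAt_besselHeatKernel_space hμ hτ hz hy).deriv

/-! ### Gaussian and off-diagonal bounds -/

theorem besselHeatKernel_nonneg {μ : ℝ} (hμ : -1 < μ) {τ x y : ℝ} (hτ : 0 < τ)
    (hx : 0 < x) (hy : 0 < y) : 0 ≤ besselHeatKernel μ τ x y := by
  have := besselI_nonneg hμ (z := x * y / (2 * τ)) (by positivity)
  unfold besselHeatKernel
  positivity

/-- Completing the square: (x²+y²)/4τ = xy/2τ + (x-y)²/4τ. This exhibits the kernel as a Gaussian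
times a function that is bounded away from 0. -/
theorem besselHeatKernel_eq_scaled (μ : ℝ) {τ x y : ℝ} (hτ : 0 < τ) (hx : 0 < x) (hy : 0 < y) :
    besselHeatKernel μ τ x y = (Real.sqrt (2 * τ))⁻¹ * besselIScaled μ (x * y / (2 * τ)) *
      Real.exp (-(x - y) ^ 2 / (4 * τ)) := by
  have e : Real.exp (-(x ^ 2 + y ^ 2) / (4 * τ)) =
      Real.exp (-(x * y / (2 * τ))) * Real.exp (-(x - y) ^ 2 / (4 * τ)) := by
    rw [← Real.exp_add]
    congr 1
    field_simp
    ring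
  have h1 : 0 < Real.sqrt (2 * τ) := by positivity
  have h2 : (2 * τ) = Real.sqrt (2 * τ) * Real.sqrt (2 * τ) :=
    (Real.mul_self_sqrt (by positivity)).symm
  rw [besselHeatKernel, besselIScaled, e, Real.sqrt_div (by positivity)]
  have h3 : Real.sqrt (x * y) / (2 * τ) =
      Real.sqrt (x * y) / (Real.sqrt (2 * τ) * Real.sqrt (2 * τ)) := by rw [← h2]
  rw [h3]
  field_simp

theorem continuousOn_besselHeatKernel {μ : ℝ} (hμ : -1 < μ) :
    ContinuousOn (fun p : ℝ × ℝ × ℝ => besselHeatKernel μ p.1 p.2.1 p.2.2)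
      (Ioi 0 ×ˢ Ioi 0 ×ˢ Ioi 0) := by
  have hpos : ∀ p ∈ (Ioi 0 ×ˢ Ioi 0 ×ˢ Ioi 0 : Set (ℝ × ℝ × ℝ)), 0 < p.1 ∧ 0 < p.2.1 ∧ 0 < p.2.2 :=
    fun p hp => ⟨hp.1, hp.2.1, hp.2.2⟩
  unfold besselHeatKernel
  refine ((ContinuousOn.div (by fun_prop) (by fun_prop) fun p hp => ?_).mul
    ((continuousOn_besselI hμ).comp (ContinuousOn.div (by fun_prop) (by fun_prop) fun p hp => ?_)
      fun p hp => ?_)).mul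
    (Real.continuous_exp.comp_continuousOn
      (ContinuousOn.div (by fun_prop) (by fun_prop) fun p hp => ?_))
  · have := (hpos p hp).1; positivity
  · have := (hpos p hp).1; positivity
  · have := hpos p hp
    obtain ⟨h1, h2, h3⟩ := this
    exact div_pos (mul_pos h2 h3) (mul_pos two_pos h1)
  · have := (hpos p hp).1; positivity

theorem continuousOn_besselHeatKernelDt {μ : ℝ} (hμ : -1 < μ) :
    ContinuousOn (fun p : ℝ × ℝ × ℝ => besselHeatKernelDt μ p.1 p.2.1 p.2.2)
      (Ioi 0 ×ˢ Ioi 0 ×ˢ Ioi 0) := by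
  have h0 := continuousOn_besselHeatKernel hμ
  have h1 := continuousOn_besselHeatKernel (μ := μ + 1) (by linarith)
  have h : ContinuousOn (fun p : ℝ × ℝ × ℝ =>
      (-(μ + 1) / p.1 + (p.2.1 ^ 2 + p.2.2 ^ 2) / (4 * p.1 ^ 2)) *
        besselHeatKernel μ p.1 p.2.1 p.2.2 -
        p.2.1 * p.2.2 / (2 * p.1 ^ 2) * besselHeatKernel (μ + 1) p.1 p.2.1 p.2.2)
      (Ioi 0 ×ˢ Ioi 0 ×ˢ Ioi 0) := by
    refine (ContinuousOn.mul (ContinuousOn.add ?_ ?_) h0).sub (ContinuousOn.mul ?_ h1)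
    all_goals
      refine ContinuousOn.div (by fun_prop) (by fun_prop) fun p hp => ?_
      have : 0 < p.1 := hp.1
      positivity
  exact h.congr fun p hp => besselHeatKernelDt_eq hμ hp.1 hp.2.1 hp.2.2

theorem continuousOn_besselHeatKernelDx {μ : ℝ} (hμ : -1 < μ) :
    ContinuousOn (fun p : ℝ × ℝ × ℝ => besselHeatKernelDx μ p.1 p.2.1 p.2.2)
      (Ioi 0 ×ˢ Ioi 0 ×ˢ Ioi 0) := by
  have h0 := continuousOn_besselHeatKernel hμ
  have h1 := continuousOn_besselHeatKernel (μ := μ + 1) (by linarith)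
  unfold besselHeatKernelDx
  refine (ContinuousOn.mul (ContinuousOn.sub ?_ ?_) h0).add (ContinuousOn.mul ?_ h1)
  all_goals
    refine ContinuousOn.div (by fun_prop) (by fun_prop) fun p hp => ?_
    have h1 : 0 < p.1 := hp.1
    have h2 : 0 < p.2.1 := hp.2.1
    positivity

theorem continuousOn_besselHeatKernelDxx {μ : ℝ} (hμ : -1 < μ) :
    ContinuousOn (fun p : ℝ × ℝ × ℝ => besselHeatKernelDxx μ p.1 p.2.1 p.2.2)
      (Ioi 0 ×ˢ Ioi 0 ×ˢ Ioi 0) := by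
  have h : ContinuousOn (fun p : ℝ × ℝ × ℝ => besselHeatKernelDt μ p.1 p.2.1 p.2.2 -
      (1 / 4 - μ ^ 2) / p.2.1 ^ 2 * besselHeatKernel μ p.1 p.2.1 p.2.2)
      (Ioi 0 ×ˢ Ioi 0 ×ˢ Ioi 0) := by
    refine (continuousOn_besselHeatKernelDt hμ).sub
      (ContinuousOn.mul ?_ (continuousOn_besselHeatKernel hμ))
    refine ContinuousOn.div (by fun_prop) (by fun_prop) fun p hp => ?_
    have h2 : 0 < p.2.1 := hp.2.1
    positivity
  exact h.congr fun p hp => besselHeatKernelDxx_eq hμ hp.1 hp.2.1 hp.2.2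

/-- Gaussian upper bound for the kernel on a compact range of all variables. -/
theorem exists_besselHeatKernel_le {μ : ℝ} (hμ : -1 < μ) {x₁ a T : ℝ} (hx₁ : 0 < x₁) (ha : 0 < a)
    (hT : 0 < T) :
    ∃ C : ℝ, 0 < C ∧ ∀ τ x y : ℝ, 0 < τ → τ ≤ T → x₁ ≤ x → a ≤ y →
      besselHeatKernel μ τ x y ≤ C * (Real.sqrt τ)⁻¹ * Real.exp (-(x - y) ^ 2 / (4 * τ)) := by
  -- x₁a/(2T) is the least value of xy/(2τ) over the allowed range.
  obtain ⟨C, hC, h⟩ := exists_besselIScaled_le hμ (z₀ := x₁ * a / (2 * T)) (by positivity)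
  refine ⟨C, hC, fun τ x y hτ hτT hx hy => ?_⟩
  have hx0 := hx₁.trans_le hx
  have hy0 := ha.trans_le hy
  rw [besselHeatKernel_eq_scaled μ hτ hx0 hy0, mul_comm C]
  have h1 : besselIScaled μ (x * y / (2 * τ)) ≤ C := h _ (by gcongr)
  have h0 : 0 ≤ besselIScaled μ (x * y / (2 * τ)) := by
    have := besselI_nonneg hμ (z := x * y / (2 * τ)) (by positivity)
    unfold besselIScaled
    positivity
  have h2 : (Real.sqrt (2 * τ))⁻¹ ≤ (Real.sqrt τ)⁻¹ :=
    inv_anti₀ (by positivity) (Real.sqrt_le_sqrt (by linarith))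
  gcongr

theorem exp_neg_le_div_pow {v : ℝ} (hv : 0 < v) (n : ℕ) :
    Real.exp (-v) ≤ (n.factorial : ℝ) / v ^ n := by
  have h := Real.pow_div_factorial_le_exp v hv.le n
  rw [Real.exp_neg, ← inv_div]
  exact inv_anti₀ (by positivity) h

/-- Off the diagonal `∂W/∂τ` is bounded, and `W` is `O(τ)`. -/
theorem exists_off_diagonal_bound {μ : ℝ} (hμ : -1 < μ) {x a b T ε : ℝ} (hx : 0 < x) (ha : 0 < a)
    (hT : 0 < T) (hε : 0 < ε) :
    ∃ C : ℝ, ∀ τ y : ℝ, 0 < τ → τ ≤ T → a ≤ y → y ≤ b → ε < |x - y| →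
      |besselHeatKernelDt μ τ x y| ≤ C ∧ besselHeatKernel μ τ x y ≤ C * τ := by
  obtain ⟨C₀, hC₀, h₀⟩ := exists_besselHeatKernel_le hμ hx ha hT
  obtain ⟨C₁, hC₁, h₁⟩ := exists_besselHeatKernel_le (μ := μ + 1) (by linarith) hx ha hT
  -- From e^{-v} ≤ 3!/v³ with v = ε²/(4τ). The cube leaves τ³/√τ = √τ·τ², enough to cancel the
  -- τ^{-2} in the formula for ∂W/∂τ.
  set M := (6 : ℝ) / (ε ^ 2 / 4) ^ 3 with hM
  have hM0 : 0 < M := by positivity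
  have hexp : ∀ τ y : ℝ, 0 < τ → τ ≤ T → ε < |x - y| →
      (Real.sqrt τ)⁻¹ * Real.exp (-(x - y) ^ 2 / (4 * τ)) ≤ M * Real.sqrt T * τ ^ 2 := by
    intro τ y hτ hτT hy
    have h1 : -(x - y) ^ 2 / (4 * τ) ≤ -(ε ^ 2 / 4 / τ) := by
      have : ε ^ 2 ≤ (x - y) ^ 2 := by
        rw [← sq_abs (x - y)]
        gcongr
      rw [neg_div, neg_le_neg_iff, div_div]
      gcongr
    have h2 := (Real.exp_le_exp.2 h1).trans
      (exp_neg_le_div_pow (v := ε ^ 2 / 4 / τ) (by positivity) 3)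
    have h3 : ((3 : ℕ).factorial : ℝ) / (ε ^ 2 / 4 / τ) ^ 3 = M * τ ^ 3 := by
      rw [hM, div_pow, Nat.factorial]
      norm_num [Nat.factorial]
      field_simp
    rw [h3] at h2
    have hs : 0 < Real.sqrt τ := by positivity
    calc (Real.sqrt τ)⁻¹ * Real.exp (-(x - y) ^ 2 / (4 * τ))
        ≤ (Real.sqrt τ)⁻¹ * (M * τ ^ 3) := by gcongr
      _ = M * Real.sqrt τ * τ ^ 2 := by
        have : τ ^ 3 = Real.sqrt τ * Real.sqrt τ * τ ^ 2 := by
          rw [Real.mul_self_sqrt hτ.le]; ring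
        rw [this]
        field_simp
      _ ≤ M * Real.sqrt T * τ ^ 2 := by gcongr
  have hb : ∀ (C : ℝ) (ν : ℝ), -1 < ν → 0 < C → (∀ τ x' y : ℝ, 0 < τ → τ ≤ T → x ≤ x' → a ≤ y →
      besselHeatKernel ν τ x' y ≤ C * (Real.sqrt τ)⁻¹ * Real.exp (-(x' - y) ^ 2 / (4 * τ))) →
      ∀ τ y : ℝ, 0 < τ → τ ≤ T → a ≤ y → ε < |x - y| →
      besselHeatKernel ν τ x y ≤ C * (M * Real.sqrt T) * τ ^ 2 := by
    intro C ν hν hC h τ y hτ hτT hy hxy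
    refine (h τ x y hτ hτT le_rfl hy).trans ?_
    rw [mul_assoc, mul_assoc C]
    exact mul_le_mul_of_nonneg_left (hexp τ y hτ hτT hxy) hC.le
  set D₀ := C₀ * (M * Real.sqrt T)
  set D₁ := C₁ * (M * Real.sqrt T)
  -- The first two summands bound the two terms of ∂W/∂τ; the last bounds W/τ, through τ² ≤ Tτ.
  refine ⟨((|μ + 1|) * T + (x ^ 2 + b ^ 2) / 4) * D₀ + x * b / 2 * D₁ + D₀ * T,
    fun τ y hτ hτT hay hyb hxy => ?_⟩
  have hy : 0 < y := ha.trans_le hay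
  have k0 := hb C₀ μ hμ hC₀ h₀ τ y hτ hτT hay hxy
  have k1 := hb C₁ (μ + 1) (by linarith) hC₁ h₁ τ y hτ hτT hay hxy
  have n0 := besselHeatKernel_nonneg hμ hτ hx hy
  have n1 := besselHeatKernel_nonneg (μ := μ + 1) (by linarith) hτ hx hy
  have hD₀ : 0 < D₀ := by positivity
  have hD₁ : 0 < D₁ := by positivity
  have hb0 : 0 < b := hy.trans_le hyb
  have hy2 : y ^ 2 ≤ b ^ 2 := by gcongr
  constructor
  · rw [besselHeatKernelDt_eq hμ hτ hx hy]
    have t1 : |(-(μ + 1) / τ + (x ^ 2 + y ^ 2) / (4 * τ ^ 2)) * besselHeatKernel μ τ x y| ≤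
        ((|μ + 1|) * T + (x ^ 2 + b ^ 2) / 4) * D₀ := by
      rw [abs_mul, abs_of_nonneg n0]
      have : |(-(μ + 1) / τ + (x ^ 2 + y ^ 2) / (4 * τ ^ 2))| ≤
          (|μ + 1| * T + (x ^ 2 + b ^ 2) / 4) / τ ^ 2 := by
        refine (abs_add_le (-(μ + 1) / τ) ((x ^ 2 + y ^ 2) / (4 * τ ^ 2))).trans ?_
        rw [abs_div, abs_neg, abs_of_pos hτ,
          abs_of_nonneg (by positivity : 0 ≤ (x ^ 2 + y ^ 2) / (4 * τ ^ 2)), add_div (|μ + 1| * T)]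
        refine add_le_add ?_ ?_
        · rw [div_le_div_iff₀ hτ (by positivity)]
          nlinarith [mul_nonneg (mul_nonneg (abs_nonneg (μ + 1)) hτ.le) (sub_nonneg.2 hτT)]
        · rw [div_div]
          gcongr
      calc _ ≤ (|μ + 1| * T + (x ^ 2 + b ^ 2) / 4) / τ ^ 2 * (D₀ * τ ^ 2) := by gcongr
        _ = _ := by field_simp
    have t2 : |x * y / (2 * τ ^ 2) * besselHeatKernel (μ + 1) τ x y| ≤ x * b / 2 * D₁ := by
      rw [abs_of_nonneg (by positivity)]
      calc _ ≤ x * b / (2 * τ ^ 2) * (D₁ * τ ^ 2) := by gcongr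
        _ = _ := by field_simp
    have t3 : 0 < D₀ * T := by positivity
    rw [← Real.norm_eq_abs] at t1 t2 ⊢
    refine (norm_sub_le _ _).trans ?_
    linarith
  · have t4 : besselHeatKernel μ τ x y ≤ D₀ * T * τ := by
      refine k0.trans ?_
      have : τ ^ 2 ≤ T * τ := by nlinarith
      nlinarith
    have t5 : 0 ≤ ((|μ + 1|) * T + (x ^ 2 + b ^ 2) / 4) * D₀ + x * b / 2 * D₁ := by positivity
    nlinarith

/-! ### Integrable majorant and strip-supported data -/

/-- `τ^(-1/2)` cut off to `(0,T] × [a,b]`. -/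
noncomputable def kernelMajorant (T a b : ℝ) : ℝ × ℝ → ℝ :=
  (Ioc 0 T ×ˢ Icc a b).indicator fun p => (Real.sqrt p.1)⁻¹

theorem kernelMajorant_nonneg (T a b : ℝ) (p : ℝ × ℝ) : 0 ≤ kernelMajorant T a b p :=
  indicator_nonneg (fun _ _ => by positivity) _

theorem integrable_kernelMajorant {T : ℝ} (hT : 0 < T) (a b : ℝ) :
    Integrable (kernelMajorant T a b) := by
  have hm : MeasurableSet (Ioc 0 T ×ˢ Icc a b : Set (ℝ × ℝ)) :=
    measurableSet_Ioc.prod measurableSet_Icc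
  refine (integrable_indicator_iff hm).2 ?_
  rw [IntegrableOn, Measure.volume_eq_prod, ← Measure.prod_restrict]
  have h1 : Integrable (fun τ : ℝ => (Real.sqrt τ)⁻¹) (volume.restrict (Ioc 0 T)) := by
    have := (intervalIntegrable_iff_integrableOn_Ioc_of_le hT.le).1
      (intervalIntegral.intervalIntegrable_rpow' (a := 0) (b := T) (r := -(1 / 2)) (by norm_num))
    refine this.congr_fun (fun τ hτ => ?_) measurableSet_Ioc
    rw [Real.sqrt_eq_rpow, ← Real.rpow_neg hτ.1.le]
  have h2 : Integrable (fun _ : ℝ => (1 : ℝ)) (volume.restrict (Icc a b)) :=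
    integrableOn_const (by simp)
  simpa using h1.mul_prod h2

theorem measurableSet_quadrant : MeasurableSet (Ioi (0 : ℝ) ×ˢ Ioi (0 : ℝ)) :=
  measurableSet_Ioi.prod measurableSet_Ioi

theorem continuousOn_kernel_slice {H : ℝ → ℝ → ℝ → ℝ}
    (hH : ContinuousOn (fun p : ℝ × ℝ × ℝ => H p.1 p.2.1 p.2.2) (Ioi 0 ×ˢ Ioi 0 ×ˢ Ioi 0))
    {x : ℝ} (hx : 0 < x) :
    ContinuousOn (fun p : ℝ × ℝ => (H p.1 x p.2 : ℂ)) (Ioi (0 : ℝ) ×ˢ Ioi (0 : ℝ)) :=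
  Complex.continuous_ofReal.comp_continuousOn
    (hH.comp (f := fun p : ℝ × ℝ => (p.1, x, p.2)) (by fun_prop) fun p hp => ⟨hp.1, hx, hp.2⟩)

/-- The Gaussian factor is discarded. The constant is uniform in x ≥ x₁ and in the value c of the
data, so one majorant serves for varying x and for all time shifts of f. -/
theorem exists_kernel_mul_le_majorant {μ : ℝ} (hμ : -1 < μ) {x₁ a T : ℝ} (b : ℝ) (hx₁ : 0 < x₁)
    (ha : 0 < a) (hT : 0 < T) (M : ℝ) (hM : 0 ≤ M) :
    ∃ C : ℝ, 0 ≤ C ∧ ∀ x, x₁ ≤ x → ∀ p ∈ Ioi (0 : ℝ) ×ˢ Ioi (0 : ℝ), ∀ c : ℂ, ‖c‖ ≤ M →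
      (p ∉ Iic T ×ˢ Icc a b → c = 0) →
      ‖(besselHeatKernel μ p.1 x p.2 : ℂ) * c‖ ≤ C * kernelMajorant T a b p := by
  obtain ⟨C, hC, h⟩ := exists_besselHeatKernel_le hμ hx₁ ha hT
  refine ⟨C * M, by positivity, fun x hx p hp c hc h0 => ?_⟩
  by_cases hpK : p ∈ Iic T ×ˢ Icc a b
  · have hp1 : 0 < p.1 := hp.1
    have hp2 : 0 < p.2 := hp.2
    have hmem : p ∈ Ioc 0 T ×ˢ Icc a b := ⟨⟨hp1, hpK.1⟩, hpK.2⟩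
    have hn := besselHeatKernel_nonneg hμ hp1 (hx₁.trans_le hx) hp2
    rw [norm_mul, Complex.norm_real, Real.norm_of_nonneg hn, kernelMajorant,
      indicator_of_mem hmem]
    have h1 := h p.1 x p.2 hp1 hpK.1 hx hpK.2.1
    have h2 : Real.exp (-(x - p.2) ^ 2 / (4 * p.1)) ≤ 1 := by
      rw [Real.exp_le_one_iff, neg_div]
      have : 0 ≤ (x - p.2) ^ 2 / (4 * p.1) := by positivity
      linarith
    have h3 : besselHeatKernel μ p.1 x p.2 ≤ C * (Real.sqrt p.1)⁻¹ := by
      refine h1.trans (mul_le_of_le_one_right (by positivity) h2)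
    calc besselHeatKernel μ p.1 x p.2 * ‖c‖ ≤ C * (Real.sqrt p.1)⁻¹ * M := by gcongr
      _ = C * M * (Real.sqrt p.1)⁻¹ := by ring
  · rw [h0 hpK, mul_zero, norm_zero]
    exact mul_nonneg (by positivity) (kernelMajorant_nonneg _ _ _ _)

theorem integrableOn_kernel_mul_of_bounded {μ : ℝ} (hμ : -1 < μ) {x a b T M : ℝ} (hx : 0 < x)
    (ha : 0 < a) (hT : 0 < T) (hM : 0 ≤ M) {g : ℝ × ℝ → ℂ}
    (hg : AEStronglyMeasurable g (volume.restrict (Ioi (0 : ℝ) ×ˢ Ioi (0 : ℝ))))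
    (hb : ∀ᵐ p ∂(volume.restrict (Ioi (0 : ℝ) ×ˢ Ioi (0 : ℝ))), ‖g p‖ ≤ M)
    (h0 : ∀ᵐ p ∂(volume.restrict (Ioi (0 : ℝ) ×ˢ Ioi (0 : ℝ))),
      p ∉ Iic T ×ˢ Icc a b → g p = 0) :
    IntegrableOn (fun p : ℝ × ℝ => (besselHeatKernel μ p.1 x p.2 : ℂ) * g p)
      (Ioi (0 : ℝ) ×ˢ Ioi (0 : ℝ)) := by
  obtain ⟨C, -, h⟩ := exists_kernel_mul_le_majorant hμ b hx ha hT M hM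
  refine Integrable.mono' ((integrable_kernelMajorant hT a b).integrableOn.const_mul C)
    (((continuousOn_kernel_slice (continuousOn_besselHeatKernel hμ) hx).aestronglyMeasurable
      measurableSet_quadrant).mul hg) ?_
  filter_upwards [hb, h0, ae_restrict_mem measurableSet_quadrant] with p h1 h2 hp
  exact h x le_rfl p hp _ h1 h2

/-- A bounded continuous function vanishing outside `(-∞,T] × [a,b]` with `T, a > 0`. -/
structure IsStripSupported (φ : ℝ × ℝ → ℂ) (T a b M : ℝ) : Prop where
  continuous : Continuous φ
  pos_time : 0 < T
  pos_left : 0 < a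
  norm_le : ∀ p, ‖φ p‖ ≤ M
  eq_zero : ∀ p, p ∉ Iic T ×ˢ Icc a b → φ p = 0

namespace IsStripSupported

variable {φ : ℝ × ℝ → ℂ} {T a b M : ℝ}

theorem bound_nonneg (h : IsStripSupported φ T a b M) : 0 ≤ M :=
  (norm_nonneg _).trans (h.norm_le 0)

theorem integrableOn_kernel_mul (h : IsStripSupported φ T a b M) {μ : ℝ} (hμ : -1 < μ) {x : ℝ}
    (hx : 0 < x) :
    IntegrableOn (fun p : ℝ × ℝ => (besselHeatKernel μ p.1 x p.2 : ℂ) * φ p)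
      (Ioi (0 : ℝ) ×ˢ Ioi (0 : ℝ)) :=
  integrableOn_kernel_mul_of_bounded hμ hx h.pos_left h.pos_time h.bound_nonneg
    h.continuous.aestronglyMeasurable (Eventually.of_forall h.norm_le)
    (Eventually.of_forall h.eq_zero)

/-- For τ > ε the data live on a compact subset of the open quadrant, where H is continuous. -/
theorem integrableOn_mul_of_pos_time (h : IsStripSupported φ T a b M) {H : ℝ × ℝ → ℂ}
    (hH : ContinuousOn H (Ioi (0 : ℝ) ×ˢ Ioi (0 : ℝ))) {ε : ℝ} (hε : 0 < ε) :
    IntegrableOn (fun p => H p * φ p) (Ioi ε ×ˢ Ioi (0 : ℝ)) := by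
  have hc : IntegrableOn (fun p => H p * φ p) (Icc ε T ×ˢ Icc a b) := by
    refine ContinuousOn.integrableOn_compact (isCompact_Icc.prod isCompact_Icc) ?_
    refine (hH.mono ?_).mul h.continuous.continuousOn
    exact prod_mono (fun τ hτ => hε.trans_le hτ.1) fun y hy => h.pos_left.trans_le hy.1
  refine IntegrableOn.of_forall_sdiff_eq_zero hc (measurableSet_Ioi.prod measurableSet_Ioi) ?_
  rintro p ⟨hp, hp'⟩
  rw [h.eq_zero p fun hp2 => hp' ⟨⟨(mem_Ioi.1 hp.1).le, hp2.1⟩, hp2.2⟩, mul_zero]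

theorem continuousOn_potential (h : IsStripSupported φ T a b M) {μ : ℝ} (hμ : -1 < μ) :
    ContinuousOn (fun x => ∫ p in Ioi (0 : ℝ) ×ˢ Ioi (0 : ℝ),
      (besselHeatKernel μ p.1 x p.2 : ℂ) * φ p) (Ioi 0) := by
  intro x (hx : 0 < x)
  refine ContinuousAt.continuousWithinAt ?_
  obtain ⟨C, -, hC⟩ := exists_kernel_mul_le_majorant hμ b (half_pos hx) h.pos_left h.pos_time M
    h.bound_nonneg
  refine continuousAt_of_dominated (bound := fun p => C * kernelMajorant T a b p) ?_ ?_
    ((integrable_kernelMajorant h.pos_time a b).integrableOn.const_mul C) ?_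
  · filter_upwards [lt_mem_nhds hx] with z hz
    exact (h.integrableOn_kernel_mul hμ hz).aestronglyMeasurable
  · filter_upwards [lt_mem_nhds (half_lt_self hx)] with z hz
    filter_upwards [ae_restrict_mem measurableSet_quadrant] with p hp
    exact hC z hz.le p hp _ (h.norm_le p) (h.eq_zero p)
  · filter_upwards [ae_restrict_mem measurableSet_quadrant] with p hp
    refine ContinuousAt.mul ?_ continuousAt_const
    exact Complex.continuous_ofReal.continuousAt.comp
      (hasDerivAt_besselHeatKernel_space hμ hp.1 hx hp.2).continuousAt

end IsStripSupported

/-! ### Limits of truncated integrals -/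

theorem tendsto_sq_nhdsGT_zero : Tendsto (fun ε : ℝ => ε ^ 2) (𝓝[>] 0) (𝓝[>] 0) := by
  refine tendsto_nhdsWithin_iff.2 ⟨?_, ?_⟩
  · have : Tendsto (fun ε : ℝ => ε ^ 2) (𝓝 0) (𝓝 (0 ^ 2)) := (continuous_pow 2).tendsto 0
    rw [zero_pow two_ne_zero] at this
    exact this.mono_left nhdsWithin_le_nhds
  · filter_upwards [self_mem_nhdsWithin] with ε (hε : 0 < ε)
    exact mem_Ioi.2 (by positivity)

theorem tendsto_integral_pos_time {F : ℝ × ℝ → ℂ}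
    (hF : IntegrableOn F (Ioi (0 : ℝ) ×ˢ Ioi (0 : ℝ))) :
    Tendsto (fun ε : ℝ => ∫ p in Ioi ε ×ˢ Ioi (0 : ℝ), F p) (𝓝[>] 0)
      (𝓝 (∫ p in Ioi (0 : ℝ) ×ˢ Ioi (0 : ℝ), F p)) := by
  have hm : ∀ ε : ℝ, MeasurableSet (Ioi ε ×ˢ Ioi (0 : ℝ)) := fun ε =>
    measurableSet_Ioi.prod measurableSet_Ioi
  have hF' := (integrable_indicator_iff measurableSet_quadrant).2 hF
  simp_rw [← integral_indicator (hm _)]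
  have hle : ∀ ε : ℝ, 0 < ε → ∀ p, (Ioi ε ×ˢ Ioi (0 : ℝ)).indicator F p =
      (Ioi ε ×ˢ Ioi (0 : ℝ)).indicator ((Ioi (0 : ℝ) ×ˢ Ioi (0 : ℝ)).indicator F) p := by
    intro ε hε p
    rw [indicator_indicator, inter_eq_self_of_subset_left]
    exact prod_mono (Ioi_subset_Ioi hε.le) Subset.rfl
  refine tendsto_integral_filter_of_dominated_convergence
    (fun p => ‖(Ioi (0 : ℝ) ×ˢ Ioi (0 : ℝ)).indicator F p‖) ?_ ?_ hF'.norm ?_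
  · filter_upwards [self_mem_nhdsWithin] with ε (hε : 0 < ε)
    rw [funext (hle ε hε)]
    exact hF'.aestronglyMeasurable.indicator (hm ε)
  · filter_upwards [self_mem_nhdsWithin] with ε (hε : 0 < ε)
    refine Eventually.of_forall fun p => ?_
    rw [hle ε hε]
    exact norm_indicator_le_norm_self _ _
  · refine Eventually.of_forall fun p => tendsto_const_nhds.congr' ?_
    by_cases hp : p ∈ Ioi (0 : ℝ) ×ˢ Ioi (0 : ℝ)
    · filter_upwards [nhdsWithin_le_nhds (gt_mem_nhds (mem_Ioi.1 hp.1))] with ε hε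
      rw [indicator_of_mem hp, indicator_of_mem (show p ∈ Ioi ε ×ˢ Ioi (0 : ℝ) from ⟨hε, hp.2⟩)]
    · filter_upwards [self_mem_nhdsWithin] with ε (hε : 0 < ε)
      rw [indicator_of_notMem hp, indicator_of_notMem]
      exact fun hp' => hp ⟨hε.trans hp'.1, hp'.2⟩

/-- Every point with τ > 0 leaves the region once ε² < τ, so dominated convergence gives 0 whatever
the sets S ε are. -/
theorem tendsto_integral_short_time {F : ℝ × ℝ → ℂ}
    (hF : IntegrableOn F (Ioi (0 : ℝ) ×ˢ Ioi (0 : ℝ))) {S : ℝ → Set ℝ}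
    (hS : ∀ ε, MeasurableSet (S ε)) (hS0 : ∀ ε, S ε ⊆ Ioi 0) :
    Tendsto (fun ε : ℝ => ∫ p in Ioc 0 (ε ^ 2) ×ˢ S ε, F p) (𝓝[>] 0) (𝓝 0) := by
  have hm : ∀ ε : ℝ, MeasurableSet (Ioc 0 (ε ^ 2) ×ˢ S ε) := fun ε =>
    measurableSet_Ioc.prod (hS ε)
  have hF' := (integrable_indicator_iff measurableSet_quadrant).2 hF
  simp_rw [← integral_indicator (hm _)]
  have hle : ∀ ε : ℝ, ∀ p, (Ioc 0 (ε ^ 2) ×ˢ S ε).indicator F p =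
      (Ioc 0 (ε ^ 2) ×ˢ S ε).indicator ((Ioi (0 : ℝ) ×ˢ Ioi (0 : ℝ)).indicator F) p := by
    intro ε p
    rw [indicator_indicator, inter_eq_self_of_subset_left]
    exact prod_mono (fun τ hτ => hτ.1) (hS0 ε)
  rw [← integral_zero (ℝ × ℝ) ℂ (μ := volume)]
  refine tendsto_integral_filter_of_dominated_convergence
    (fun p => ‖(Ioi (0 : ℝ) ×ˢ Ioi (0 : ℝ)).indicator F p‖) ?_ ?_ hF'.norm ?_
  · refine Eventually.of_forall fun ε => ?_
    rw [funext (hle ε)]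
    exact hF'.aestronglyMeasurable.indicator (hm ε)
  · refine Eventually.of_forall fun ε => Eventually.of_forall fun p => ?_
    rw [hle ε]
    exact norm_indicator_le_norm_self _ _
  · refine Eventually.of_forall fun p => tendsto_const_nhds.congr' ?_
    rcases le_or_gt p.1 0 with hp | hp
    · refine Eventually.of_forall fun ε => ?_
      exact (indicator_of_notMem (fun hp' => absurd hp'.1.1 hp.not_gt) _).symm
    · filter_upwards [(tendsto_sq_nhdsGT_zero.mono_right nhdsWithin_le_nhds).eventually (gt_mem_nhds hp)] with ε hε
      exact (indicator_of_notMem (fun hp' => absurd hp'.1.2 hε.not_ge) _).symm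

/-! ### The kernel as an approximate identity -/

theorem integrable_gaussian_quarter : Integrable fun w : ℝ => Real.exp (-w ^ 2 / 4) := by
  refine (integrable_exp_neg_mul_sq (b := 1 / 4) (by norm_num)).congr
    (Eventually.of_forall fun w => ?_)
  simp only
  congr 1
  ring

theorem integral_comp_add_sqrt_mul {δ : ℝ} (hδ : 0 < δ) (x : ℝ) (g : ℝ → ℂ) :
    ∫ y, g y = ∫ w, ((Real.sqrt δ : ℝ) : ℂ) * g (x + Real.sqrt δ * w) := by
  have hs : 0 < Real.sqrt δ := by positivity
  rw [integral_const_mul, Measure.integral_comp_mul_left (fun y => g (x + y)) (Real.sqrt δ),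
    integral_add_left_eq_self g x, abs_of_pos (inv_pos.2 hs), Complex.real_smul, ← mul_assoc,
    ← Complex.ofReal_mul, mul_inv_cancel₀ hs.ne', Complex.ofReal_one, one_mul]

/-- In the variable w the Gaussian no longer depends on δ; only the Bessel argument moves, to
infinity as δ → 0. -/
theorem sqrt_mul_besselHeatKernel (μ : ℝ) {δ x w : ℝ} (hδ : 0 < δ) (hx : 0 < x)
    (hy : 0 < x + Real.sqrt δ * w) :
    Real.sqrt δ * besselHeatKernel μ δ x (x + Real.sqrt δ * w) =
      (Real.sqrt 2)⁻¹ * besselIScaled μ (x * (x + Real.sqrt δ * w) / (2 * δ)) *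
        Real.exp (-w ^ 2 / 4) := by
  have hs : 0 < Real.sqrt δ := by positivity
  have e : -(x - (x + Real.sqrt δ * w)) ^ 2 / (4 * δ) = -w ^ 2 / 4 := by
    have : (x - (x + Real.sqrt δ * w)) ^ 2 = δ * w ^ 2 := by
      nth_rewrite 2 [← Real.mul_self_sqrt hδ.le]
      ring
    rw [this]
    field_simp
  rw [besselHeatKernel_eq_scaled μ hδ hx hy, e, Real.sqrt_mul two_pos.le]
  field_simp

namespace IsStripSupported

variable {φ : ℝ × ℝ → ℂ} {T a b M : ℝ}

/-- The kernel is an approximate identity, also when it is restricted to `√δ`-dilates of a set. -/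
theorem tendsto_integral_dilate (h : IsStripSupported φ T a b M) {μ : ℝ} (hμ : -1 < μ) {x : ℝ}
    (hx : 0 < x) {E : Set ℝ} (hE : MeasurableSet E) :
    Tendsto (fun δ : ℝ => ∫ y in {y | 0 < y ∧ (y - x) / Real.sqrt δ ∈ E},
        (besselHeatKernel μ δ x y : ℂ) * φ (δ, y)) (𝓝[>] 0)
      (𝓝 ((((2 * Real.sqrt Real.pi)⁻¹ * ∫ w in E, Real.exp (-w ^ 2 / 4) : ℝ) : ℂ) *
        φ (0, x))) := by
  -- The integrand after y = x + √δ w, extended by zero. It is dominated by CM e^{-w²/4} and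
  -- converges pointwise.
  set G : ℝ → ℝ → ℂ := fun δ w => ((Real.sqrt δ : ℝ) : ℂ) *
    {y | 0 < y ∧ (y - x) / Real.sqrt δ ∈ E}.indicator
      (fun y => (besselHeatKernel μ δ x y : ℂ) * φ (δ, y)) (x + Real.sqrt δ * w) with hG
  have hmS : ∀ δ : ℝ, MeasurableSet {y | 0 < y ∧ (y - x) / Real.sqrt δ ∈ E} := fun δ =>
    measurableSet_Ioi.inter ((by fun_prop : Measurable fun y : ℝ => (y - x) / Real.sqrt δ) hE)
  have hlim : ((((2 * Real.sqrt Real.pi)⁻¹ * ∫ w in E, Real.exp (-w ^ 2 / 4) : ℝ) : ℂ) *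
      φ (0, x)) = ∫ w, E.indicator
        (fun w => (((2 * Real.sqrt Real.pi)⁻¹ * Real.exp (-w ^ 2 / 4) : ℝ) : ℂ) * φ (0, x)) w := by
    rw [integral_indicator hE, integral_mul_const, integral_complex_ofReal, integral_const_mul]
  have hmem : ∀ δ w : ℝ, 0 < δ → (x + Real.sqrt δ * w ∈
      {y | 0 < y ∧ (y - x) / Real.sqrt δ ∈ E} ↔ 0 < x + Real.sqrt δ * w ∧ w ∈ E) := by
    intro δ w hδ
    have hs : Real.sqrt δ ≠ 0 := by positivity
    rw [mem_ofPred_eq, add_sub_cancel_left, mul_div_cancel_left₀ _ hs]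
  have hint := integrable_gaussian_quarter
  obtain ⟨C, hC, hbd⟩ := exists_besselHeatKernel_le hμ hx h.pos_left h.pos_time
  have hM := h.bound_nonneg
  rw [hlim]
  have hmain : Tendsto (fun δ => ∫ w, G δ w) (𝓝[>] 0) (𝓝 (∫ w, E.indicator
      (fun w => (((2 * Real.sqrt Real.pi)⁻¹ * Real.exp (-w ^ 2 / 4) : ℝ) : ℂ) * φ (0, x)) w)) := by
    refine tendsto_integral_filter_of_dominated_convergence
      (fun w => C * M * Real.exp (-w ^ 2 / 4)) ?_ ?_ (hint.const_mul _) ?_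
    · filter_upwards [self_mem_nhdsWithin] with δ (hδ : 0 < δ)
      have hopen : MeasurableSet {w : ℝ | 0 < x + Real.sqrt δ * w} :=
        measurableSet_lt measurable_const (by fun_prop)
      have hGE : G δ = ({w : ℝ | 0 < x + Real.sqrt δ * w} ∩ E).indicator fun w =>
          ((Real.sqrt δ : ℝ) : ℂ) * ((besselHeatKernel μ δ x (x + Real.sqrt δ * w) : ℂ) *
            φ (δ, x + Real.sqrt δ * w)) := by
        funext w
        simp only [hG]
        by_cases hw : 0 < x + Real.sqrt δ * w ∧ w ∈ E
        · rw [indicator_of_mem ((hmem δ w hδ).2 hw), indicator_of_mem]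
          exact hw
        · rw [indicator_of_notMem (fun hh => hw ((hmem δ w hδ).1 hh)), indicator_of_notMem, mul_zero]
          exact hw
      rw [hGE]
      refine (aestronglyMeasurable_indicator_iff (hopen.inter hE)).2 ?_
      refine AEStronglyMeasurable.mono_measure ?_ (Measure.restrict_mono inter_subset_left le_rfl)
      refine ContinuousOn.aestronglyMeasurable
        (continuousOn_const.mul (ContinuousOn.mul ?_ ?_)) hopen
      · exact (continuousOn_kernel_slice (continuousOn_besselHeatKernel hμ) hx).comp
          (f := fun w : ℝ => (δ, x + Real.sqrt δ * w)) (by fun_prop) fun w hw => ⟨hδ, hw⟩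
      · exact (h.continuous.comp (by fun_prop)).continuousOn
    · filter_upwards [self_mem_nhdsWithin, nhdsWithin_le_nhds (gt_mem_nhds h.pos_time)] with
        δ (hδ : 0 < δ) hδT
      refine Eventually.of_forall fun w => ?_
      simp only [hG]
      by_cases hw : x + Real.sqrt δ * w ∈ {y | 0 < y ∧ (y - x) / Real.sqrt δ ∈ E}
      · rw [indicator_of_mem hw, ← mul_assoc, ← Complex.ofReal_mul]
        by_cases hy : x + Real.sqrt δ * w ∈ Icc a b
        · have hk := hbd δ x _ hδ hδT.le le_rfl hy.1
          have hn := besselHeatKernel_nonneg hμ hδ hx hw.1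
          have hs : 0 < Real.sqrt δ := by positivity
          have e : -(x - (x + Real.sqrt δ * w)) ^ 2 / (4 * δ) = -w ^ 2 / 4 := by
            have : (x - (x + Real.sqrt δ * w)) ^ 2 = δ * w ^ 2 := by
              nth_rewrite 2 [← Real.mul_self_sqrt hδ.le]
              ring
            rw [this]
            field_simp
          rw [e] at hk
          rw [norm_mul, Complex.norm_real, Real.norm_of_nonneg (by positivity)]
          have hk2 : Real.sqrt δ * besselHeatKernel μ δ x (x + Real.sqrt δ * w) ≤
              C * Real.exp (-w ^ 2 / 4) := by
            calc _ ≤ Real.sqrt δ * (C * (Real.sqrt δ)⁻¹ * Real.exp (-w ^ 2 / 4)) := by gcongr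
              _ = _ := by field_simp
          calc _ ≤ C * Real.exp (-w ^ 2 / 4) * M := by
                gcongr
                exact h.norm_le _
            _ = _ := by ring
        · rw [h.eq_zero _ fun hp => hy hp.2, mul_zero, norm_zero]
          positivity
      · rw [indicator_of_notMem hw, mul_zero, norm_zero]
        positivity
    · refine Eventually.of_forall fun w => ?_
      have hs0 : Tendsto (fun δ : ℝ => Real.sqrt δ) (𝓝[>] 0) (𝓝 0) := by
        have := Real.continuous_sqrt.tendsto 0
        rw [Real.sqrt_zero] at this
        exact this.mono_left nhdsWithin_le_nhds
      have hy0 : Tendsto (fun δ : ℝ => x + Real.sqrt δ * w) (𝓝[>] 0) (𝓝 x) := by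
        simpa using (hs0.mul_const w).const_add x
      by_cases hw : w ∈ E
      · rw [indicator_of_mem hw]
        have hz : Tendsto (fun δ : ℝ => x * (x + Real.sqrt δ * w) / (2 * δ)) (𝓝[>] 0) atTop := by
          have h1 : Tendsto (fun δ : ℝ => x * (x + Real.sqrt δ * w) / 2) (𝓝[>] 0)
              (𝓝 (x * x / 2)) := (hy0.const_mul x).div_const 2
          refine (h1.pos_mul_atTop (by positivity) tendsto_inv_nhdsGT_zero).congr fun δ => ?_
          rw [← div_eq_mul_inv, div_div]
        have h2 := ((((tendsto_besselIScaled hμ).comp hz).const_mul (Real.sqrt 2)⁻¹).mul_const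
          (Real.exp (-w ^ 2 / 4)))
        have h3 : Tendsto (fun δ : ℝ => φ (δ, x + Real.sqrt δ * w)) (𝓝[>] 0) (𝓝 (φ (0, x))) := by
          refine (h.continuous.tendsto (0, x)).comp ?_
          exact (tendsto_nhdsWithin_of_tendsto_nhds tendsto_id).prodMk_nhds hy0
        have h4 := ((Complex.continuous_ofReal.tendsto _).comp h2).mul h3
        -- The factor 2^{-1/2} of the kernel and the limit (2π)^{-1/2} combine into the
        -- normalisation of e^{-w²/4}.
        have hc : (Real.sqrt 2)⁻¹ * (Real.sqrt (2 * Real.pi))⁻¹ * Real.exp (-w ^ 2 / 4) =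
            (2 * Real.sqrt Real.pi)⁻¹ * Real.exp (-w ^ 2 / 4) := by
          rw [Real.sqrt_mul two_pos.le, ← mul_inv, ← mul_assoc, Real.mul_self_sqrt two_pos.le]
        rw [hc] at h4
        refine h4.congr' ?_
        filter_upwards [self_mem_nhdsWithin, hy0.eventually (lt_mem_nhds hx)] with
          δ (hδ : 0 < δ) hy
        simp only [hG, Function.comp]
        rw [indicator_of_mem ((hmem δ w hδ).2 ⟨hy, hw⟩), ← sqrt_mul_besselHeatKernel μ hδ hx hy]
        push_cast
        ring
      · rw [indicator_of_notMem hw]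
        refine tendsto_const_nhds.congr' ?_
        filter_upwards [self_mem_nhdsWithin] with δ (hδ : 0 < δ)
        simp only [hG]
        rw [indicator_of_notMem fun hh => hw ((hmem δ w hδ).1 hh).2, mul_zero]
  refine hmain.congr' ?_
  filter_upwards [self_mem_nhdsWithin] with δ (hδ : 0 < δ)
  rw [← integral_indicator (hmS δ)]
  exact (integral_comp_add_sqrt_mul hδ x _).symm

/-- The dominating Gaussian has mass independent of δ. The bound controls the boundary term at τ = δ
uniformly in x when Taylor remainders pass to the limit. -/
theorem exists_norm_integral_slice_le (h : IsStripSupported φ T a b M) {μ : ℝ} (hμ : -1 < μ)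
    {x₁ : ℝ} (hx₁ : 0 < x₁) :
    ∃ C : ℝ, ∀ δ x : ℝ, 0 < δ → δ ≤ T → x₁ ≤ x →
      ‖∫ y in Ioi (0 : ℝ), (besselHeatKernel μ δ x y : ℂ) * φ (δ, y)‖ ≤ C := by
  obtain ⟨C, hC, hbd⟩ := exists_besselHeatKernel_le hμ hx₁ h.pos_left h.pos_time
  have hM := h.bound_nonneg
  refine ⟨C * M * Real.sqrt (4 * Real.pi), fun δ x hδ hδT hx => ?_⟩
  have hs : 0 < Real.sqrt δ := by positivity
  have hx0 := hx₁.trans_le hx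
  have hint : Integrable fun y : ℝ => C * M * (Real.sqrt δ)⁻¹ *
      Real.exp (-(1 / (4 * δ)) * (y - x) ^ 2) :=
    ((integrable_exp_neg_mul_sq (b := 1 / (4 * δ)) (by positivity)).comp_sub_right x).const_mul _
  have hval : ∫ y : ℝ, C * M * (Real.sqrt δ)⁻¹ * Real.exp (-(1 / (4 * δ)) * (y - x) ^ 2) =
      C * M * Real.sqrt (4 * Real.pi) := by
    rw [integral_const_mul,
      integral_sub_right_eq_self (fun y : ℝ => Real.exp (-(1 / (4 * δ)) * y ^ 2)) x,
      integral_gaussian]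
    have e : Real.pi / (1 / (4 * δ)) = δ * (4 * Real.pi) := by field_simp
    rw [e, Real.sqrt_mul hδ.le]
    field_simp
  rw [← hval]
  refine (norm_integral_le_of_norm_le hint.integrableOn ?_).trans
    (setIntegral_le_integral hint (Eventually.of_forall fun y => ?_))
  · filter_upwards [ae_restrict_mem measurableSet_Ioi] with y (hy : 0 < y)
    by_cases hyK : y ∈ Icc a b
    · have hn := besselHeatKernel_nonneg hμ hδ hx0 hy
      rw [norm_mul, Complex.norm_real, Real.norm_of_nonneg hn]
      have h1 := hbd δ x y hδ hδT hx hyK.1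
      have e : -(x - y) ^ 2 / (4 * δ) = -(1 / (4 * δ)) * (y - x) ^ 2 := by
        field_simp
        ring
      rw [e] at h1
      calc _ ≤ C * (Real.sqrt δ)⁻¹ * Real.exp (-(1 / (4 * δ)) * (y - x) ^ 2) * M := by
            gcongr
            exact h.norm_le _
        _ = _ := by ring
    · rw [h.eq_zero _ fun hp => hyK hp.2, mul_zero, norm_zero]
      positivity
  · simp only [Pi.zero_apply]
    positivity

end IsStripSupported

/-! ### Integration by parts in time -/

/-- The part of the half line at distance more than `ε` from `x`. -/
def awayFrom (x ε : ℝ) : Set ℝ := {y | 0 < y ∧ ε < |x - y|}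

theorem measurableSet_awayFrom (x ε : ℝ) : MeasurableSet (awayFrom x ε) :=
  measurableSet_Ioi.inter (measurableSet_lt (f := fun _ : ℝ => ε) (g := fun y : ℝ => |x - y|) measurable_const
    (by fun_prop))

theorem awayFrom_subset (x ε : ℝ) : awayFrom x ε ⊆ Ioi 0 := fun _ hy => hy.1

/-- Here φ(τ,y) = f(t-τ,y) and ψ is the time derivative of f at t-τ; the reflection produces the
minus sign. -/
theorem hasDerivAt_kernel_mul {μ : ℝ} (hμ : -1 < μ) {φ ψ : ℝ × ℝ → ℂ}
    (hd : ∀ τ y, HasDerivAt (fun s => φ (s, y)) (-ψ (τ, y)) τ) {τ x y : ℝ} (hτ : 0 < τ)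
    (hx : 0 < x) (hy : 0 < y) :
    HasDerivAt (fun s => (besselHeatKernel μ s x y : ℂ) * φ (s, y))
      ((besselHeatKernelDt μ τ x y : ℂ) * φ (τ, y) -
        (besselHeatKernel μ τ x y : ℂ) * ψ (τ, y)) τ := by
  have h := (hasDerivAt_besselHeatKernel_time hμ hτ hx hy)
  rw [← besselHeatKernelDt_eq hμ hτ hx hy] at h
  refine (h.ofReal_comp.mul (hd τ y)).congr_deriv ?_
  ring

namespace IsStripSupported

variable {φ ψ : ℝ × ℝ → ℂ} {T a b M M' : ℝ}

/-- By Fubini the τ-integral is taken first. The integrand ∂_τW φ - Wψ is the exact derivative of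
Wφ, which vanishes for τ > T, so only the endpoint δ contributes. -/
theorem integral_Dt_pos_time (h : IsStripSupported φ T a b M) (h' : IsStripSupported ψ T a b M')
    (hd : ∀ τ y, HasDerivAt (fun s => φ (s, y)) (-ψ (τ, y)) τ) {μ : ℝ} (hμ : -1 < μ) {x δ : ℝ}
    (hx : 0 < x) (hδ : 0 < δ) :
    ∫ p in Ioi δ ×ˢ Ioi (0 : ℝ), (besselHeatKernelDt μ p.1 x p.2 : ℂ) * φ p =
      (∫ p in Ioi δ ×ˢ Ioi (0 : ℝ), (besselHeatKernel μ p.1 x p.2 : ℂ) * ψ p) -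
        ∫ y in Ioi (0 : ℝ), (besselHeatKernel μ δ x y : ℂ) * φ (δ, y) := by
  have i1 := h.integrableOn_mul_of_pos_time
    (continuousOn_kernel_slice (continuousOn_besselHeatKernelDt hμ) hx) hδ
  have i2 := h'.integrableOn_mul_of_pos_time
    (continuousOn_kernel_slice (continuousOn_besselHeatKernel hμ) hx) hδ
  rw [sub_eq_add_neg, ← sub_eq_iff_eq_add', ← integral_sub i1 i2]
  have i3 := i1.sub i2
  rw [Pi.sub_def, IntegrableOn, Measure.volume_eq_prod, ← Measure.prod_restrict] at i3
  rw [Measure.volume_eq_prod, ← Measure.prod_restrict, integral_prod_symm _ i3, ← integral_neg]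
  refine integral_congr_ae ?_
  filter_upwards [i3.prod_left_ae, ae_restrict_mem measurableSet_Ioi] with y hy (hy0 : 0 < y)
  have hder : ∀ τ ∈ Ici δ, HasDerivAt (fun s => (besselHeatKernel μ s x y : ℂ) * φ (s, y))
      ((besselHeatKernelDt μ τ x y : ℂ) * φ (τ, y) -
        (besselHeatKernel μ τ x y : ℂ) * ψ (τ, y)) τ := fun τ hτ =>
    hasDerivAt_kernel_mul hμ hd (hδ.trans_le hτ) hx hy0
  have hz : Tendsto (fun s => (besselHeatKernel μ s x y : ℂ) * φ (s, y)) atTop (𝓝 0) := by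
    refine tendsto_const_nhds.congr' ?_
    filter_upwards [eventually_gt_atTop T] with s hs
    rw [h.eq_zero (s, y) fun hp => hs.not_ge hp.1, mul_zero]
  rw [integral_Ioi_of_hasDerivAt_of_tendsto' hder hy hz, zero_sub]

/-- At distance more than ε from the diagonal ∂W/∂τ is bounded up to τ = 0, and the data have
compact support there. -/
theorem integrableOn_Dt_short_time (h : IsStripSupported φ T a b M) {μ : ℝ} (hμ : -1 < μ)
    {x ε : ℝ} (δ : ℝ) (hx : 0 < x) (hε : 0 < ε) :
    IntegrableOn (fun p : ℝ × ℝ => (besselHeatKernelDt μ p.1 x p.2 : ℂ) * φ p)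
      (Ioc 0 δ ×ˢ awayFrom x ε) := by
  obtain ⟨C, hC⟩ := exists_off_diagonal_bound (b := b) hμ hx h.pos_left h.pos_time hε
  have hM := h.bound_nonneg
  have hm : MeasurableSet (Ioc 0 δ ×ˢ awayFrom x ε) :=
    measurableSet_Ioc.prod (measurableSet_awayFrom x ε)
  have hsub : Ioc 0 δ ×ˢ awayFrom x ε ⊆ Ioi (0 : ℝ) ×ˢ Ioi (0 : ℝ) :=
    prod_mono (fun τ hτ => hτ.1) (awayFrom_subset x ε)
  have hc : IntegrableOn (fun p : ℝ × ℝ => (besselHeatKernelDt μ p.1 x p.2 : ℂ) * φ p)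
      ((Ioc 0 δ ×ˢ awayFrom x ε) ∩ (Icc 0 T ×ˢ Icc a b)) := by
    refine IntegrableOn.of_bound (C := C * M) ?_ ?_ ?_
    · refine (measure_mono inter_subset_right).trans_lt ?_
      exact (isCompact_Icc.prod isCompact_Icc).measure_lt_top
    · refine AEStronglyMeasurable.mono_measure ?_
        (Measure.restrict_mono (inter_subset_left.trans hsub) le_rfl)
      exact ((continuousOn_kernel_slice (continuousOn_besselHeatKernelDt hμ) hx).mul
        h.continuous.continuousOn).aestronglyMeasurable measurableSet_quadrant
    · filter_upwards [ae_restrict_mem (hm.inter (measurableSet_Icc.prod measurableSet_Icc))] with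
        p hp
      have h1 := (hC p.1 p.2 hp.1.1.1 hp.2.1.2 hp.2.2.1 hp.2.2.2 hp.1.2.2).1
      rw [norm_mul, Complex.norm_real, Real.norm_eq_abs]
      exact mul_le_mul h1 (h.norm_le p) (norm_nonneg _) ((abs_nonneg _).trans h1)
  refine IntegrableOn.of_forall_sdiff_eq_zero hc hm ?_
  rintro p ⟨hp, hp'⟩
  rw [h.eq_zero p fun hp2 => hp' ⟨hp, ⟨hp.1.1.le, hp2.1⟩, hp2.2⟩, mul_zero]

/-- The boundary term at τ = 0 vanishes because W = O(τ) off the diagonal; now δ is the upper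
endpoint, which reverses the sign. -/
theorem integral_Dt_short_time (h : IsStripSupported φ T a b M) (h' : IsStripSupported ψ T a b M')
    (hd : ∀ τ y, HasDerivAt (fun s => φ (s, y)) (-ψ (τ, y)) τ) {μ : ℝ} (hμ : -1 < μ) {x δ ε : ℝ}
    (hx : 0 < x) (hδ : 0 < δ) (hε : 0 < ε) :
    ∫ p in Ioc 0 δ ×ˢ awayFrom x ε, (besselHeatKernelDt μ p.1 x p.2 : ℂ) * φ p =
      (∫ p in Ioc 0 δ ×ˢ awayFrom x ε, (besselHeatKernel μ p.1 x p.2 : ℂ) * ψ p) +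
        ∫ y in awayFrom x ε, (besselHeatKernel μ δ x y : ℂ) * φ (δ, y) := by
  have hsub : Ioc 0 δ ×ˢ awayFrom x ε ⊆ Ioi (0 : ℝ) ×ˢ Ioi (0 : ℝ) :=
    prod_mono (fun τ hτ => hτ.1) (awayFrom_subset x ε)
  have i1 := h.integrableOn_Dt_short_time hμ δ hx hε
  have i2 := (h'.integrableOn_kernel_mul hμ hx).mono_set hsub
  rw [← sub_eq_iff_eq_add', ← integral_sub i1 i2]
  have i3 := i1.sub i2
  rw [Pi.sub_def, IntegrableOn, Measure.volume_eq_prod, ← Measure.prod_restrict] at i3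
  rw [Measure.volume_eq_prod, ← Measure.prod_restrict, integral_prod_symm _ i3]
  refine integral_congr_ae ?_
  filter_upwards [i3.prod_left_ae, ae_restrict_mem (measurableSet_awayFrom x ε)] with y hy hyA
  have hy0 : 0 < y := hyA.1
  have hder : ∀ τ : ℝ, 0 < τ → HasDerivAt (fun s => (besselHeatKernel μ s x y : ℂ) * φ (s, y))
      ((besselHeatKernelDt μ τ x y : ℂ) * φ (τ, y) -
        (besselHeatKernel μ τ x y : ℂ) * ψ (τ, y)) τ := fun τ hτ =>
    hasDerivAt_kernel_mul hμ hd hτ hx hy0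
  have hz : Tendsto (fun s => (besselHeatKernel μ s x y : ℂ) * φ (s, y)) (𝓝[>] 0) (𝓝 0) := by
    obtain ⟨C, hC⟩ := exists_off_diagonal_bound (b := b) hμ hx h.pos_left h.pos_time hε
    have hlim : Tendsto (fun s : ℝ => C * s * M) (𝓝[>] 0) (𝓝 0) := by
      have : Tendsto (fun s : ℝ => C * s * M) (𝓝 0) (𝓝 (C * 0 * M)) :=
        (by fun_prop : Continuous fun s : ℝ => C * s * M).tendsto 0
      rw [mul_zero, zero_mul] at this
      exact this.mono_left nhdsWithin_le_nhds
    have hM := h.bound_nonneg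
    by_cases hyK : y ∈ Icc a b
    · refine squeeze_zero_norm' ?_ hlim
      filter_upwards [self_mem_nhdsWithin, nhdsWithin_le_nhds (gt_mem_nhds h.pos_time)] with
        s (hs : 0 < s) hsT
      have h1 := (hC s y hs hsT.le hyK.1 hyK.2 hyA.2).2
      have hn := besselHeatKernel_nonneg hμ hs hx hy0
      rw [norm_mul, Complex.norm_real, Real.norm_of_nonneg hn]
      exact mul_le_mul h1 (h.norm_le _) (norm_nonneg _) (hn.trans h1)
    · refine tendsto_const_nhds.congr fun s => ?_
      rw [h.eq_zero _ fun hp => hyK hp.2, mul_zero]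
  have hint := (intervalIntegrable_iff_integrableOn_Ioc_of_le hδ.le).2 hy
  have key := intervalIntegral.integral_eq_sub_of_hasDerivAt_of_tendsto hδ
    (fun τ hτ => hder τ hτ.1) hint hz ((hder δ hδ).continuousAt.tendsto.mono_left
      nhdsWithin_le_nhds)
  rw [intervalIntegral.integral_of_le hδ.le, sub_zero] at key
  exact key

end IsStripSupported

/-! ### The parabolic region and the constant A -/

/-- A split into two disjoint product sets, on each of which integration by parts in τ applies. -/
theorem parabolicRegion_eq {x ε : ℝ} (hε : 0 < ε) :
    parabolicRegion ε x = Ioi (ε ^ 2) ×ˢ Ioi (0 : ℝ) ∪ Ioc 0 (ε ^ 2) ×ˢ awayFrom x ε := by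
  have hsq : ∀ τ : ℝ, ε < Real.sqrt τ ↔ ε ^ 2 < τ := fun τ => Real.lt_sqrt hε.le
  ext p
  simp only [parabolicRegion, awayFrom, mem_union, mem_prod, mem_Ioi, mem_Ioc, mem_ofPred_eq,
    lt_max_iff, hsq]
  constructor
  · rintro ⟨h1, h2, h3⟩
    rcases lt_or_ge (ε ^ 2) p.1 with h | h
    · exact Or.inl ⟨h, h2⟩
    · exact Or.inr ⟨⟨h1, h⟩, h2, h3.resolve_left h.not_gt⟩
  · rintro (⟨h1, h2⟩ | ⟨⟨h1, h2⟩, h3, h4⟩)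
    · exact ⟨(sq_nonneg ε).trans_lt h1, h2, Or.inl h1⟩
    · exact ⟨h1, h3, Or.inr h4⟩

theorem setIntegral_parabolicRegion {x ε : ℝ} (hε : 0 < ε) {F : ℝ × ℝ → ℂ}
    (h1 : IntegrableOn F (Ioi (ε ^ 2) ×ˢ Ioi (0 : ℝ)))
    (h2 : IntegrableOn F (Ioc 0 (ε ^ 2) ×ˢ awayFrom x ε)) :
    ∫ p in parabolicRegion ε x, F p =
      (∫ p in Ioi (ε ^ 2) ×ˢ Ioi (0 : ℝ), F p) + ∫ p in Ioc 0 (ε ^ 2) ×ˢ awayFrom x ε, F p := by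
  rw [parabolicRegion_eq hε]
  refine setIntegral_union ?_ (measurableSet_Ioc.prod (measurableSet_awayFrom x ε)) h1 h2
  exact disjoint_left.2 fun p hp hp' => (mem_Ioi.1 hp.1).not_ge hp'.1.2

/-- On the slice τ = ε² the natural variable is w = (y-x)/ε; hence the endpoint 1 in the integral
defining A. -/
theorem awayFrom_eq_dilate {x ε : ℝ} (hε : 0 < ε) :
    awayFrom x ε = {y | 0 < y ∧ (y - x) / Real.sqrt (ε ^ 2) ∈ {w : ℝ | 1 < |w|}} := by
  ext y
  simp only [awayFrom, mem_ofPred_eq]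
  rw [Real.sqrt_sq hε.le, abs_div, abs_of_pos hε, one_lt_div hε, abs_sub_comm]

theorem integral_gaussian_quarter : ∫ w : ℝ, Real.exp (-w ^ 2 / 4) = 2 * Real.sqrt Real.pi := by
  have h := integral_gaussian (1 / 4)
  have e : Real.pi / (1 / 4) = 2 ^ 2 * Real.pi := by ring
  rw [e, Real.sqrt_mul (by positivity), Real.sqrt_sq two_pos.le] at h
  rw [← h]
  congr 1
  funext w
  congr 1
  ring

/-- Total mass 2√π, minus the mass of [-1,1], which by symmetry is 2∫₀¹. -/
theorem integral_gaussian_quarter_tail :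
    (2 * Real.sqrt Real.pi)⁻¹ * ∫ w in {w : ℝ | 1 < |w|}, Real.exp (-w ^ 2 / 4) = 1 - constA := by
  have hint := integrable_gaussian_quarter
  have hset : {w : ℝ | 1 < |w|} = (Icc (-1) 1)ᶜ := by
    ext w
    simp only [mem_ofPred_eq, mem_compl_iff, mem_Icc, ← abs_le, not_le]
  have h := integral_add_compl (measurableSet_Icc (a := (-1 : ℝ)) (b := 1)) hint
  rw [← hset, integral_gaussian_quarter, integral_Icc_eq_integral_Ioc,
    ← intervalIntegral.integral_of_le (by norm_num)] at h
  have hi : ∀ c d : ℝ, IntervalIntegrable (fun w : ℝ => Real.exp (-w ^ 2 / 4)) volume c d :=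
    fun c d => hint.intervalIntegrable
  have hsymm : ∫ w in (-1 : ℝ)..0, Real.exp (-w ^ 2 / 4) =
      ∫ w in (0 : ℝ)..1, Real.exp (-w ^ 2 / 4) := by
    have := intervalIntegral.integral_comp_neg (a := 0) (b := 1)
      (fun w : ℝ => Real.exp (-w ^ 2 / 4))
    simpa using this.symm
  rw [← intervalIntegral.integral_add_adjacent_intervals (hi (-1) 0) (hi 0 1), hsymm] at h
  have hp : 0 < Real.sqrt Real.pi := by positivity
  rw [constA, eq_sub_iff_add_eq'.2 h]
  field_simp
  ring

namespace IsStripSupported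

variable {φ ψ : ℝ × ℝ → ℂ} {T a b M M' : ℝ}

theorem tendsto_integral_slice (h : IsStripSupported φ T a b M) {μ : ℝ} (hμ : -1 < μ) {x : ℝ}
    (hx : 0 < x) :
    Tendsto (fun δ : ℝ => ∫ y in Ioi (0 : ℝ), (besselHeatKernel μ δ x y : ℂ) * φ (δ, y)) (𝓝[>] 0)
      (𝓝 (φ (0, x))) := by
  have key := h.tendsto_integral_dilate hμ hx MeasurableSet.univ
  have hp : 2 * Real.sqrt Real.pi ≠ 0 := by positivity
  rw [Measure.restrict_univ, integral_gaussian_quarter, inv_mul_cancel₀ hp, Complex.ofReal_one,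
    one_mul] at key
  simpa [Ioi] using key

theorem tendsto_integral_slice_away (h : IsStripSupported φ T a b M) {μ : ℝ} (hμ : -1 < μ) {x : ℝ}
    (hx : 0 < x) :
    Tendsto (fun ε : ℝ => ∫ y in awayFrom x ε, (besselHeatKernel μ (ε ^ 2) x y : ℂ) *
      φ (ε ^ 2, y)) (𝓝[>] 0) (𝓝 (((1 - constA : ℝ) : ℂ) * φ (0, x))) := by
  have key := h.tendsto_integral_dilate hμ hx (E := {w : ℝ | 1 < |w|})
    (measurableSet_lt measurable_const (by fun_prop))
  rw [integral_gaussian_quarter_tail] at key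
  refine (key.comp tendsto_sq_nhdsGT_zero).congr' ?_
  filter_upwards [self_mem_nhdsWithin] with ε (hε : 0 < ε)
  rw [awayFrom_eq_dilate hε]
  rfl

theorem tendsto_integral_Dt (h : IsStripSupported φ T a b M) (h' : IsStripSupported ψ T a b M')
    (hd : ∀ τ y, HasDerivAt (fun s => φ (s, y)) (-ψ (τ, y)) τ) {μ : ℝ} (hμ : -1 < μ) {x : ℝ}
    (hx : 0 < x) :
    Tendsto (fun ε : ℝ => ∫ p in Ioi ε ×ˢ Ioi (0 : ℝ),
        (besselHeatKernelDt μ p.1 x p.2 : ℂ) * φ p) (𝓝[>] 0)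
      (𝓝 ((∫ p in Ioi (0 : ℝ) ×ˢ Ioi (0 : ℝ), (besselHeatKernel μ p.1 x p.2 : ℂ) * ψ p) -
        φ (0, x))) := by
  refine ((tendsto_integral_pos_time (h'.integrableOn_kernel_mul hμ hx)).sub
    (h.tendsto_integral_slice hμ hx)).congr' ?_
  filter_upwards [self_mem_nhdsWithin] with ε (hε : 0 < ε)
  exact (h.integral_Dt_pos_time h' hd hμ hx hε).symm

theorem tendsto_integral_Dt_short_time (h : IsStripSupported φ T a b M)
    (h' : IsStripSupported ψ T a b M')
    (hd : ∀ τ y, HasDerivAt (fun s => φ (s, y)) (-ψ (τ, y)) τ) {μ : ℝ} (hμ : -1 < μ) {x : ℝ}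
    (hx : 0 < x) :
    Tendsto (fun ε : ℝ => ∫ p in Ioc 0 (ε ^ 2) ×ˢ awayFrom x ε,
        (besselHeatKernelDt μ p.1 x p.2 : ℂ) * φ p) (𝓝[>] 0)
      (𝓝 (((1 - constA : ℝ) : ℂ) * φ (0, x))) := by
  have key := (tendsto_integral_short_time (h'.integrableOn_kernel_mul hμ hx)
    (measurableSet_awayFrom x) (awayFrom_subset x)).add (h.tendsto_integral_slice_away hμ hx)
  rw [zero_add] at key
  refine key.congr' ?_
  filter_upwards [self_mem_nhdsWithin] with ε (hε : 0 < ε)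
  exact (h.integral_Dt_short_time h' hd hμ hx (by positivity) hε).symm

end IsStripSupported

/-! ### Time derivative of the potential -/

/-- The time variable occurs only in F, so the kernel is not differentiated and its integrable
majorant dominates. A single strip serves for all s within distance 1 of t. -/
theorem hasDerivAt_potential_time {μ : ℝ} (hμ : -1 < μ) {F F' : ℝ × ℝ → ℂ} {t x T a b M M' : ℝ}
    (hx : 0 < x)
    (hF : ∀ s ∈ Metric.ball t 1, IsStripSupported (fun p => F (s - p.1, p.2)) T a b M)
    (hF' : ∀ s ∈ Metric.ball t 1, IsStripSupported (fun p => F' (s - p.1, p.2)) T a b M')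
    (hd : ∀ s y, HasDerivAt (fun r => F (r, y)) (F' (s, y)) s) :
    HasDerivAt (fun s => ∫ p in Ioi (0 : ℝ) ×ˢ Ioi (0 : ℝ),
        (besselHeatKernel μ p.1 x p.2 : ℂ) * F (s - p.1, p.2))
      (∫ p in Ioi (0 : ℝ) ×ˢ Ioi (0 : ℝ),
        (besselHeatKernel μ p.1 x p.2 : ℂ) * F' (t - p.1, p.2)) t := by
  have ht : t ∈ Metric.ball t 1 := Metric.mem_ball_self one_pos
  have h0 := hF' t ht
  obtain ⟨C, -, hC⟩ := exists_kernel_mul_le_majorant hμ b hx h0.pos_left h0.pos_time M'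
    h0.bound_nonneg
  refine (hasDerivAt_integral_of_dominated_loc_of_deriv_le
    (bound := fun p => C * kernelMajorant T a b p) (Metric.ball_mem_nhds t one_pos) ?_
    ((hF t ht).integrableOn_kernel_mul hμ hx)
    (F := fun s p => (besselHeatKernel μ p.1 x p.2 : ℂ) * F (s - p.1, p.2))
    (F' := fun s p => (besselHeatKernel μ p.1 x p.2 : ℂ) * F' (s - p.1, p.2))
    (h0.integrableOn_kernel_mul hμ hx).aestronglyMeasurable ?_
    ((integrable_kernelMajorant h0.pos_time a b).integrableOn.const_mul C) ?_).2
  · filter_upwards [Metric.ball_mem_nhds t one_pos] with s hs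
    exact ((hF s hs).integrableOn_kernel_mul hμ hx).aestronglyMeasurable
  · filter_upwards [ae_restrict_mem measurableSet_quadrant] with p hp s hs
    exact hC x le_rfl p hp _ ((hF' s hs).norm_le p) ((hF' s hs).eq_zero p)
  · refine Eventually.of_forall fun p s _ => ?_
    exact ((hd (s - p.1) p.2).comp_sub_const s p.1).const_mul _

/-! ### Second spatial derivative via Taylor's formula -/

/-- Second order differentiability from Taylor's formula with integral remainder. -/
theorem hasDerivAt_deriv_of_taylor {u g : ℝ → ℂ} {x : ℝ} {B : ℂ} (hx : 0 < x)
    (hg : ContinuousOn g (Ioi 0))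
    (h : ∀ z, 0 < z → u z = u x + ((z - x : ℝ) : ℂ) * B + ∫ s in x..z, ((z - s : ℝ) : ℂ) * g s) :
    DifferentiableAt ℝ u x ∧ HasDerivAt (deriv u) (g x) x := by
  have hsub : ∀ z, 0 < z → uIcc x z ⊆ Ioi 0 := fun z hz s hs => (lt_min hx hz).trans_le hs.1
  have hsg : ContinuousOn (fun s : ℝ => (s : ℂ) * g s) (Ioi 0) :=
    Complex.continuous_ofReal.continuousOn.mul hg
  have hint : ∀ k : ℝ → ℂ, ContinuousOn k (Ioi 0) → ∀ z, 0 < z →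
      HasDerivAt (fun z => ∫ s in x..z, k s) (k z) z := fun k hk z hz =>
    intervalIntegral.integral_hasDerivAt_right ((hk.mono (hsub z hz)).intervalIntegrable)
      (hk.stronglyMeasurableAtFilter isOpen_Ioi z hz) (hk.continuousAt (Ioi_mem_nhds hz))
  have hu : ∀ z, 0 < z → HasDerivAt u (B + ∫ s in x..z, g s) z := by
    intro z hz
    -- Writing z - s as two terms removes the parameter z from the integrands, so the fundamental
    -- theorem of calculus applies; the terms z g(z) cancel.
    have e : ∀ z, 0 < z → u z = u x + ((z - x : ℝ) : ℂ) * B +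
        ((z : ℂ) * (∫ s in x..z, g s) - ∫ s in x..z, (s : ℂ) * g s) := by
      intro z hz
      rw [h z hz, ← intervalIntegral.integral_const_mul, ← intervalIntegral.integral_sub
        (((hg.mono (hsub z hz)).intervalIntegrable).const_mul _)
        ((hsg.mono (hsub z hz)).intervalIntegrable)]
      congr 1
      refine intervalIntegral.integral_congr fun s _ => ?_
      push_cast
      ring
    have h1 : HasDerivAt (fun z : ℝ => ((z - x : ℝ) : ℂ)) 1 z := by
      simpa using ((hasDerivAt_id z).sub_const x).ofReal_comp
    have h2 : HasDerivAt (fun z : ℝ => (z : ℂ)) 1 z := by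
      simpa using (hasDerivAt_id z).ofReal_comp
    have h3 := ((h1.mul_const B).const_add (u x)).add
      ((h2.mul (hint g hg z hz)).sub (hint _ hsg z hz))
    refine (h3.congr_of_eventuallyEq ?_).congr_deriv ?_
    · filter_upwards [lt_mem_nhds hz] with w hw
      exact e w hw
    · ring
  refine ⟨(hu x hx).differentiableAt, ?_⟩
  refine ((hint g hg x hx).const_add B).congr_of_eventuallyEq ?_
  filter_upwards [lt_mem_nhds hx] with w hw
  exact (hu w hw).deriv

/-- The function s ↦ W(s) + (z-s) ∂_xW(s) has derivative (z-s) ∂_x²W(s). -/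
theorem besselHeatKernel_taylor {μ : ℝ} (hμ : -1 < μ) {τ x y z : ℝ} (hτ : 0 < τ) (hx : 0 < x)
    (hy : 0 < y) (hz : 0 < z) :
    besselHeatKernel μ τ z y = besselHeatKernel μ τ x y + (z - x) * besselHeatKernelDx μ τ x y +
      ∫ s in x..z, (z - s) * besselHeatKernelDxx μ τ s y := by
  have hsub : uIcc x z ⊆ Ioi 0 := fun s hs => (lt_min hx hz).trans_le hs.1
  have hder : ∀ s ∈ uIcc x z, HasDerivAt
      (fun s => besselHeatKernel μ τ s y + (z - s) * besselHeatKernelDx μ τ s y)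
      ((z - s) * besselHeatKernelDxx μ τ s y) s := by
    intro s hs
    have hs0 : 0 < s := hsub hs
    have h1 := hasDerivAt_besselHeatKernel_space hμ hτ hs0 hy
    have h2 := hasDerivAt_besselHeatKernelDx hμ hτ hs0 hy
    rw [← besselHeatKernelDxx_eq hμ hτ hs0 hy] at h2
    refine (h1.add (((hasDerivAt_id s).const_sub z).mul h2)).congr_deriv ?_
    simp only [id, besselHeatKernelDx]
    ring
  have hc : ContinuousOn (fun s => (z - s) * besselHeatKernelDxx μ τ s y) (uIcc x z) := by
    refine ContinuousOn.mul (by fun_prop) ?_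
    exact (continuousOn_besselHeatKernelDxx hμ).comp (f := fun s : ℝ => (τ, s, y)) (by fun_prop)
      fun s hs => ⟨hτ, hsub hs, hy⟩
  rw [intervalIntegral.integral_eq_sub_of_hasDerivAt hder hc.intervalIntegrable]
  ring

namespace IsStripSupported

variable {φ ψ : ℝ × ℝ → ℂ} {T a b M M' : ℝ}

theorem exists_norm_potential_le (h : IsStripSupported φ T a b M) {μ : ℝ} (hμ : -1 < μ)
    {x₁ : ℝ} (hx₁ : 0 < x₁) :
    ∃ C : ℝ, ∀ ε x : ℝ, 0 < ε → x₁ ≤ x →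
      ‖∫ p in Ioi ε ×ˢ Ioi (0 : ℝ), (besselHeatKernel μ p.1 x p.2 : ℂ) * φ p‖ ≤ C := by
  obtain ⟨C, hC0, hC⟩ := exists_kernel_mul_le_majorant hμ b hx₁ h.pos_left h.pos_time M
    h.bound_nonneg
  have hi := (integrable_kernelMajorant h.pos_time a b).const_mul C
  refine ⟨∫ p, C * kernelMajorant T a b p, fun ε x hε hx => ?_⟩
  refine (norm_integral_le_of_norm_le hi.integrableOn ?_).trans
    (setIntegral_le_integral hi (Eventually.of_forall fun p =>
      mul_nonneg hC0 (kernelMajorant_nonneg _ _ _ _)))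
  filter_upwards [ae_restrict_mem (measurableSet_Ioi.prod measurableSet_Ioi)] with p hp
  exact hC x hx p ⟨hε.trans hp.1, hp.2⟩ _ (h.norm_le p) (h.eq_zero p)

theorem integral_Dxx_pos_time (h : IsStripSupported φ T a b M) {μ : ℝ} (hμ : -1 < μ) {x ε : ℝ}
    (hx : 0 < x) (hε : 0 < ε) :
    ∫ p in Ioi ε ×ˢ Ioi (0 : ℝ), (besselHeatKernelDxx μ p.1 x p.2 : ℂ) * φ p =
      (∫ p in Ioi ε ×ˢ Ioi (0 : ℝ), (besselHeatKernelDt μ p.1 x p.2 : ℂ) * φ p) -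
        (((1 / 4 - μ ^ 2) / x ^ 2 : ℝ) : ℂ) *
          ∫ p in Ioi ε ×ˢ Ioi (0 : ℝ), (besselHeatKernel μ p.1 x p.2 : ℂ) * φ p := by
  rw [← integral_const_mul, ← integral_sub
    (h.integrableOn_mul_of_pos_time
      (continuousOn_kernel_slice (continuousOn_besselHeatKernelDt hμ) hx) hε)
    ((h.integrableOn_mul_of_pos_time
      (continuousOn_kernel_slice (continuousOn_besselHeatKernel hμ) hx) hε).const_mul _)]
  refine setIntegral_congr_fun (measurableSet_Ioi.prod measurableSet_Ioi) fun p hp => ?_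
  have hp1 : 0 < p.1 := hε.trans hp.1
  rw [besselHeatKernelDxx_eq hμ hp1 hx hp.2]
  push_cast
  ring

theorem tendsto_integral_Dxx (h : IsStripSupported φ T a b M) (h' : IsStripSupported ψ T a b M')
    (hd : ∀ τ y, HasDerivAt (fun s => φ (s, y)) (-ψ (τ, y)) τ) {μ : ℝ} (hμ : -1 < μ) {x : ℝ}
    (hx : 0 < x) :
    Tendsto (fun ε : ℝ => ∫ p in Ioi ε ×ˢ Ioi (0 : ℝ),
        (besselHeatKernelDxx μ p.1 x p.2 : ℂ) * φ p) (𝓝[>] 0)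
      (𝓝 ((∫ p in Ioi (0 : ℝ) ×ˢ Ioi (0 : ℝ), (besselHeatKernel μ p.1 x p.2 : ℂ) * ψ p) -
        φ (0, x) - (((1 / 4 - μ ^ 2) / x ^ 2 : ℝ) : ℂ) *
          ∫ p in Ioi (0 : ℝ) ×ˢ Ioi (0 : ℝ), (besselHeatKernel μ p.1 x p.2 : ℂ) * φ p)) := by
  refine ((h.tendsto_integral_Dt h' hd hμ hx).sub
    ((tendsto_integral_pos_time (h.integrableOn_kernel_mul hμ hx)).const_mul _)).congr' ?_
  filter_upwards [self_mem_nhdsWithin] with ε (hε : 0 < ε)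
  exact (h.integral_Dxx_pos_time hμ hx hε).symm

/-- Joint integrability for the exchange of the s-integral with the potential integral: for τ > ε
everything lives on a compact set where ∂_x²W is continuous. -/
theorem integrable_taylor_remainder (h : IsStripSupported φ T a b M) {μ : ℝ} (hμ : -1 < μ)
    {x z ε : ℝ} (hx : 0 < x) (hz : 0 < z) (hε : 0 < ε) :
    Integrable (Function.uncurry fun (s : ℝ) (p : ℝ × ℝ) => ((z - s : ℝ) : ℂ) *
        ((besselHeatKernelDxx μ p.1 s p.2 : ℂ) * φ p))
      ((volume.restrict (uIoc x z)).prod (volume.restrict (Ioi ε ×ˢ Ioi (0 : ℝ)))) := by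
  have hsub : uIcc x z ⊆ Ioi 0 := fun s hs => (lt_min hx hz).trans_le hs.1
  rw [Measure.prod_restrict]
  have hc : IntegrableOn (Function.uncurry fun (s : ℝ) (p : ℝ × ℝ) => ((z - s : ℝ) : ℂ) *
      ((besselHeatKernelDxx μ p.1 s p.2 : ℂ) * φ p)) (uIcc x z ×ˢ (Icc ε T ×ˢ Icc a b))
      (volume.prod volume) := by
    refine ContinuousOn.integrableOn_compact
      (isCompact_uIcc.prod (isCompact_Icc.prod isCompact_Icc)) ?_
    refine ContinuousOn.mul (by fun_prop) (ContinuousOn.mul ?_ ?_)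
    · refine Complex.continuous_ofReal.comp_continuousOn
        ((continuousOn_besselHeatKernelDxx hμ).comp
          (f := fun q : ℝ × ℝ × ℝ => (q.2.1, q.1, q.2.2)) (by fun_prop) fun q hq => ?_)
      exact ⟨hε.trans_le hq.2.1.1, hsub hq.1, h.pos_left.trans_le hq.2.2.1⟩
    · exact (h.continuous.comp continuous_snd).continuousOn
  refine IntegrableOn.of_forall_sdiff_eq_zero hc
    (measurableSet_uIoc.prod (measurableSet_Ioi.prod measurableSet_Ioi)) ?_
  rintro ⟨s, p⟩ ⟨hp, hp'⟩
  simp only [Function.uncurry]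
  rw [h.eq_zero p fun hp2 => hp' ⟨uIoc_subset_uIcc hp.1,
    ⟨(mem_Ioi.1 hp.2.1).le, hp2.1⟩, hp2.2⟩, mul_zero, mul_zero]

theorem potential_taylor_pos_time (h : IsStripSupported φ T a b M) {μ : ℝ} (hμ : -1 < μ)
    {x z ε : ℝ} (hx : 0 < x) (hz : 0 < z) (hε : 0 < ε) :
    ∫ p in Ioi ε ×ˢ Ioi (0 : ℝ), (besselHeatKernel μ p.1 z p.2 : ℂ) * φ p =
      (∫ p in Ioi ε ×ˢ Ioi (0 : ℝ), (besselHeatKernel μ p.1 x p.2 : ℂ) * φ p) +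
      ((z - x : ℝ) : ℂ) *
        (∫ p in Ioi ε ×ˢ Ioi (0 : ℝ), (besselHeatKernelDx μ p.1 x p.2 : ℂ) * φ p) +
      ∫ s in x..z, ((z - s : ℝ) : ℂ) *
        ∫ p in Ioi ε ×ˢ Ioi (0 : ℝ), (besselHeatKernelDxx μ p.1 s p.2 : ℂ) * φ p := by
  have hi := h.integrable_taylor_remainder hμ hx hz hε
  have i0 := h.integrableOn_mul_of_pos_time
    (continuousOn_kernel_slice (continuousOn_besselHeatKernel hμ) hx) hε
  have i1 := (h.integrableOn_mul_of_pos_time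
    (continuousOn_kernel_slice (continuousOn_besselHeatKernelDx hμ) hx) hε).const_mul
      ((z - x : ℝ) : ℂ)
  have i2 : IntegrableOn (fun p : ℝ × ℝ => ∫ s in x..z, ((z - s : ℝ) : ℂ) *
      ((besselHeatKernelDxx μ p.1 s p.2 : ℂ) * φ p)) (Ioi ε ×ˢ Ioi (0 : ℝ)) := by
    simp_rw [intervalIntegral.intervalIntegral_eq_integral_uIoc]
    exact hi.integral_prod_right.smul _
  simp_rw [← integral_const_mul]
  have i01 := i0.add i1
  rw [Pi.add_def] at i01
  rw [intervalIntegral_integral_swap hi, ← integral_add i0 i1, ← integral_add i01 i2]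
  refine setIntegral_congr_fun (measurableSet_Ioi.prod measurableSet_Ioi) fun p hp => ?_
  have hp1 : 0 < p.1 := hε.trans hp.1
  rw [besselHeatKernel_taylor hμ hp1 hx hp.2 hz]
  simp_rw [← mul_assoc, ← Complex.ofReal_mul]
  rw [intervalIntegral.integral_mul_const, intervalIntegral.integral_ofReal]
  push_cast
  ring

/-- ∂_x²W is too singular at τ = 0, y = x to differentiate twice under the integral. Instead the
Taylor expansions of the truncated potentials pass to the limit, which needs only convergence and
uniform bounds for the truncated integrals of ∂_x²W. -/
theorem hasDerivAt_deriv_potential (h : IsStripSupported φ T a b M)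
    (h' : IsStripSupported ψ T a b M')
    (hd : ∀ τ y, HasDerivAt (fun s => φ (s, y)) (-ψ (τ, y)) τ) {μ : ℝ} (hμ : -1 < μ) {x : ℝ}
    (hx : 0 < x) :
    DifferentiableAt ℝ (fun z => ∫ p in Ioi (0 : ℝ) ×ˢ Ioi (0 : ℝ),
      (besselHeatKernel μ p.1 z p.2 : ℂ) * φ p) x ∧
    HasDerivAt (deriv fun z => ∫ p in Ioi (0 : ℝ) ×ˢ Ioi (0 : ℝ),
        (besselHeatKernel μ p.1 z p.2 : ℂ) * φ p)
      ((∫ p in Ioi (0 : ℝ) ×ˢ Ioi (0 : ℝ), (besselHeatKernel μ p.1 x p.2 : ℂ) * ψ p) -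
        φ (0, x) - (((1 / 4 - μ ^ 2) / x ^ 2 : ℝ) : ℂ) *
          ∫ p in Ioi (0 : ℝ) ×ˢ Ioi (0 : ℝ), (besselHeatKernel μ p.1 x p.2 : ℂ) * φ p) x := by
  set u : ℝ → ℂ := fun z => ∫ p in Ioi (0 : ℝ) ×ˢ Ioi (0 : ℝ),
    (besselHeatKernel μ p.1 z p.2 : ℂ) * φ p with hu
  set v : ℝ → ℂ := fun z => ∫ p in Ioi (0 : ℝ) ×ˢ Ioi (0 : ℝ),
    (besselHeatKernel μ p.1 z p.2 : ℂ) * ψ p with hv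
  set g : ℝ → ℂ := fun z => v z - φ (0, z) - (((1 / 4 - μ ^ 2) / z ^ 2 : ℝ) : ℂ) * u z with hgdef
  have hcoef : ContinuousOn (fun z : ℝ => (((1 / 4 - μ ^ 2) / z ^ 2 : ℝ) : ℂ)) (Ioi 0) :=
    Complex.continuous_ofReal.comp_continuousOn
      (ContinuousOn.div (by fun_prop) (by fun_prop) fun z (hz : 0 < z) => by positivity)
  have hg : ContinuousOn g (Ioi 0) :=
    ((h'.continuousOn_potential hμ).sub (h.continuous.comp (by fun_prop)).continuousOn).sub
      (hcoef.mul (h.continuousOn_potential hμ))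
  have hremainder : ∀ z, 0 < z → Tendsto (fun ε : ℝ => ∫ s in x..z, ((z - s : ℝ) : ℂ) *
      ∫ p in Ioi ε ×ˢ Ioi (0 : ℝ), (besselHeatKernelDxx μ p.1 s p.2 : ℂ) * φ p) (𝓝[>] 0)
      (𝓝 (∫ s in x..z, ((z - s : ℝ) : ℂ) * g s)) := by
    intro z hz
    have hm : 0 < min x z := lt_min hx hz
    have hle : ∀ s ∈ uIoc x z, min x z ≤ s ∧ |z - s| ≤ |z - x| := fun s hs =>
      ⟨hs.1.le, abs_sub_right_of_mem_uIcc (uIoc_subset_uIcc hs)⟩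
    obtain ⟨C₁, hC₁⟩ := h.exists_norm_potential_le hμ hm
    obtain ⟨C₂, hC₂⟩ := h'.exists_norm_potential_le hμ hm
    obtain ⟨C₃, hC₃⟩ := h.exists_norm_integral_slice_le hμ hm
    refine intervalIntegral.tendsto_integral_filter_of_dominated_convergence
      -- After the heat equation and integration by parts three terms remain: the potential of ψ
      -- (C₂), the slice at τ = ε (C₃) and the zeroth-order term (C₁).
      (fun _ => |z - x| * (C₂ + C₃ + |1 / 4 - μ ^ 2| / (min x z) ^ 2 * C₁)) ?_ ?_
      intervalIntegrable_const ?_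
    · filter_upwards [self_mem_nhdsWithin] with ε (hε : 0 < ε)
      have hi := (h.integrable_taylor_remainder hμ hx hz hε).integral_prod_left
      refine hi.aestronglyMeasurable.congr (Eventually.of_forall fun s => ?_)
      simp only [Function.uncurry]
      rw [integral_const_mul]
    · filter_upwards [self_mem_nhdsWithin, nhdsWithin_le_nhds (gt_mem_nhds h.pos_time)] with
        ε (hε : 0 < ε) hεT
      refine Eventually.of_forall fun s hs => ?_
      obtain ⟨hs1, hs2⟩ := hle s hs
      have hs0 : 0 < s := hm.trans_le hs1
      rw [norm_mul, Complex.norm_real, Real.norm_eq_abs]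
      refine mul_le_mul hs2 ?_ (norm_nonneg _) (abs_nonneg _)
      rw [h.integral_Dxx_pos_time hμ hs0 hε, h.integral_Dt_pos_time h' hd hμ hs0 hε]
      have k1 := hC₁ ε s hε hs1
      have k2 := hC₂ ε s hε hs1
      have k3 := hC₃ ε s hε hεT.le hs1
      refine (norm_sub_le _ _).trans (add_le_add ((norm_sub_le _ _).trans (add_le_add k2 k3)) ?_)
      rw [norm_mul, Complex.norm_real, Real.norm_eq_abs, abs_div,
        abs_of_nonneg (sq_nonneg s)]
      refine mul_le_mul ?_ k1 (norm_nonneg _) (by positivity)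
      gcongr
    · refine Eventually.of_forall fun s hs => ?_
      exact (h.tendsto_integral_Dxx h' hd hμ (hm.trans_le (hle s hs).1)).const_mul _
  -- The first-order term converges because every other term of the expansion does; no estimate of
  -- ∂_xW is required.
  have hB : ∀ z, 0 < z → Tendsto (fun ε : ℝ => ((z - x : ℝ) : ℂ) *
      (∫ p in Ioi ε ×ˢ Ioi (0 : ℝ), (besselHeatKernelDx μ p.1 x p.2 : ℂ) * φ p)) (𝓝[>] 0)
      (𝓝 (u z - u x - ∫ s in x..z, ((z - s : ℝ) : ℂ) * g s)) := by
    intro z hz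
    refine (((tendsto_integral_pos_time (h.integrableOn_kernel_mul hμ hz)).sub
      (tendsto_integral_pos_time (h.integrableOn_kernel_mul hμ hx))).sub
      (hremainder z hz)).congr' ?_
    filter_upwards [self_mem_nhdsWithin] with ε (hε : 0 < ε)
    rw [h.potential_taylor_pos_time hμ hx hz hε]
    ring
  -- At z = x + 1 the factor z - x is 1, which isolates the limiting coefficient B. Uniqueness of
  -- limits then gives (z-x)B for every z.
  have hB1 := hB (x + 1) (by linarith)
  simp only [add_sub_cancel_left, Complex.ofReal_one, one_mul] at hB1
  refine hasDerivAt_deriv_of_taylor hx hg (fun z hz => ?_)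
    (B := u (x + 1) - u x - ∫ s in x..(x + 1), ((x + 1 - s : ℝ) : ℂ) * g s)
  have huniq := tendsto_nhds_unique (hB z hz) (hB1.const_mul ((z - x : ℝ) : ℂ))
  rw [← huniq]
  ring

end IsStripSupported

/-! ### Reduction of f to strip-supported data -/

theorem isOpen_halfPlane : IsOpen halfPlane := isOpen_univ.prod isOpen_Ioi

/-- Compactness in the open half plane gives y ≥ a > 0. If R bounds the norm on K, then s-τ ≥ -R
forces τ ≤ s+R ≤ T. -/
theorem exists_strip_of_isCompact {K : Set (ℝ × ℝ)} (hK : IsCompact K) (hKH : K ⊆ halfPlane) :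
    ∃ a R : ℝ, 0 < a ∧ ∀ s T : ℝ, s + R ≤ T → ∀ p : ℝ × ℝ, p ∉ Iic T ×ˢ Icc a R →
      (s - p.1, p.2) ∉ K := by
  obtain ⟨a, ha, haK⟩ := hK.exists_forall_le' (f := Prod.snd) continuousOn_snd (a := 0)
    fun p hp => (hKH hp).2
  obtain ⟨R, hR⟩ := hK.isBounded.subset_closedBall 0
  refine ⟨a, R, ha, fun s T hsT p hp hpK => hp ?_⟩
  have h1 := mem_closedBall_zero_iff.1 (hR hpK)
  have h2 := (norm_fst_le _).trans h1
  have h3 := (norm_snd_le _).trans h1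
  simp only [Real.norm_eq_abs] at h2 h3
  refine ⟨?_, haK (s - p.1, p.2) hpK, (le_abs_self _).trans h3⟩
  have := (abs_le.1 h2).1
  simp only [mem_Iic]
  linarith

theorem measurePreserving_time_reflection (t : ℝ) :
    MeasurePreserving (fun p : ℝ × ℝ => (t - p.1, p.2)) volume volume :=
  (volume.measurePreserving_sub_left t).prod (MeasurePreserving.id volume)

theorem integrableOn_potential {μ : ℝ} (hμ : -1 < μ) {f : ℝ × ℝ → ℂ}
    (hf : IsBoundedCompactlySupported f) (t : ℝ) {x : ℝ} (hx : 0 < x) :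
    IntegrableOn (fun p : ℝ × ℝ => (besselHeatKernel μ p.1 x p.2 : ℂ) * f (t - p.1, p.2))
      (Ioi (0 : ℝ) ×ˢ Ioi (0 : ℝ)) := by
  obtain ⟨hL, K, hK, hKH, h0⟩ := hf
  obtain ⟨a, R, ha, hstrip⟩ := exists_strip_of_isCompact hK hKH
  have hm : MeasurableSet halfPlane := isOpen_halfPlane.measurableSet
  -- f is known only almost everywhere; the measure-preserving reflection transfers its bound and
  -- its vanishing off K to f(t-τ,y).
  have hq := ((measurePreserving_time_reflection t).restrict_preimage hm).quasiMeasurePreserving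
  have hsub : Ioi (0 : ℝ) ×ˢ Ioi (0 : ℝ) ⊆
      (fun p : ℝ × ℝ => (t - p.1, p.2)) ⁻¹' halfPlane := fun p hp => ⟨mem_univ _, hp.2⟩
  have hbound : ∀ᵐ p ∂(volume.restrict halfPlane),
      ‖f p‖ ≤ (eLpNormEssSup f (volume.restrict halfPlane)).toReal := by
    filter_upwards [ae_le_eLpNormEssSup (f := f) (μ := volume.restrict halfPlane)] with p hp
    have hfin : eLpNormEssSup f (volume.restrict halfPlane) ≠ ⊤ := by
      rw [← eLpNorm_exponent_top]
      exact hL.2.ne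
    simpa using ENNReal.toReal_mono hfin hp
  have hzero : ∀ᵐ p ∂(volume.restrict halfPlane), p ∉ K → f p = 0 := by
    rw [ae_restrict_iff' (hm.diff hK.measurableSet)] at h0
    rw [ae_restrict_iff' hm]
    filter_upwards [h0] with p hp h1 h2
    exact hp ⟨h1, h2⟩
  refine integrableOn_kernel_mul_of_bounded hμ hx ha (T := |t + R| + 1) (b := R) (by positivity)
    ENNReal.toReal_nonneg
    ((hL.1.comp_quasiMeasurePreserving hq).mono_measure (Measure.restrict_mono hsub le_rfl))
    (ae_restrict_of_ae_restrict_of_subset hsub (hq.ae hbound)) ?_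
  filter_upwards [ae_restrict_of_ae_restrict_of_subset hsub (hq.ae hzero)] with p hp hpK
  exact hp (hstrip t _ (by linarith [le_abs_self (t + R)]) p hpK)

/-- A continuous f vanishing almost everywhere on the open set `halfPlane \ K` vanishes everywhere
there. As K is compact inside the half plane, the extension by zero is C¹ on the whole plane, and F'
is its time derivative. -/
theorem exists_smooth_extension {f : ℝ × ℝ → ℂ} (hf : IsBoundedCompactlySupported f)
    (hc : ContDiffOn ℝ 2 f halfPlane) :
    ∃ (F F' : ℝ × ℝ → ℂ) (a R M M' : ℝ), EqOn F f halfPlane ∧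
      (∀ s y, HasDerivAt (fun r => F (r, y)) (F' (s, y)) s) ∧
      (∀ s T, 0 < T → s + R ≤ T → IsStripSupported (fun p => F (s - p.1, p.2)) T a R M) ∧
      ∀ s T, 0 < T → s + R ≤ T → IsStripSupported (fun p => F' (s - p.1, p.2)) T a R M' := by
  obtain ⟨-, K, hK, hKH, h0⟩ := hf
  obtain ⟨a, R, ha, hstrip⟩ := exists_strip_of_isCompact hK hKH
  have hfK : EqOn f 0 (halfPlane \ K) :=
    Measure.eqOn_open_of_ae_eq h0 (isOpen_halfPlane.sdiff hK.isClosed)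
      (hc.continuousOn.mono sdiff_subset) continuousOn_const
  set F : ℝ × ℝ → ℂ := halfPlane.indicator f with hF
  have hFK : ∀ p, p ∉ K → F p = 0 := by
    intro p hp
    by_cases hpH : p ∈ halfPlane
    · rw [hF, indicator_of_mem hpH]
      exact hfK ⟨hpH, hp⟩
    · rw [hF, indicator_of_notMem hpH]
  have hFK' : ∀ p, p ∉ K → F =ᶠ[𝓝 p] fun _ => 0 := fun p hp => by
    filter_upwards [hK.isClosed.isOpen_compl.mem_nhds hp] with q hq
    exact hFK q hq
  have hFc : ContDiff ℝ 1 F := by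
    rw [contDiff_iff_contDiffAt]
    intro p
    by_cases hpK : p ∈ K
    · have hn := isOpen_halfPlane.mem_nhds (hKH hpK)
      refine ((hc.contDiffAt hn).of_le one_le_two).congr_of_eventuallyEq ?_
      filter_upwards [hn] with q hq
      rw [hF, indicator_of_mem hq]
    · exact contDiffAt_const.congr_of_eventuallyEq (hFK' p hpK)
  have hcs : HasCompactSupport F := HasCompactSupport.intro hK hFK
  set F' : ℝ × ℝ → ℂ := fun p => fderiv ℝ F p (1, 0) with hF'
  have hFc' : Continuous F' := (hFc.continuous_fderiv one_ne_zero).clm_apply continuous_const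
  have hFK'' : ∀ p, p ∉ K → F' p = 0 := fun p hp => by
    simp only [hF']
    rw [(hFK' p hp).fderiv_eq]
    simp
  obtain ⟨M, hM⟩ := hcs.exists_bound_of_continuous hFc.continuous
  obtain ⟨M', hM'⟩ := (HasCompactSupport.intro hK hFK'').exists_bound_of_continuous hFc'
  refine ⟨F, F', a, R, M, M', fun p hp => indicator_of_mem hp f, fun s y => ?_,
    fun s T hT hsT => ⟨hFc.continuous.comp (by fun_prop), hT, ha, fun p => hM _,
      fun p hp => hFK _ (hstrip s T hsT p hp)⟩,
    fun s T hT hsT => ⟨hFc'.comp (by fun_prop), hT, ha, fun p => hM' _,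
      fun p hp => hFK'' _ (hstrip s T hsT p hp)⟩⟩
  have h1 : HasFDerivAt F (fderiv ℝ F (s, y)) (s, y) :=
    (hFc.differentiable one_ne_zero _).hasFDerivAt
  exact h1.comp_hasDerivAt s ((hasDerivAt_id s).prodMk (hasDerivAt_const s y))

/-- Iterated integrals against `f` are double integrals against its extension by zero. -/
theorem iterated_integral_eq {f F : ℝ × ℝ → ℂ} (hFf : EqOn F f halfPlane) (H : ℝ → ℝ → ℝ) (t ε : ℝ)
    (hi : IntegrableOn (fun p : ℝ × ℝ => (H p.1 p.2 : ℂ) * F (t - p.1, p.2))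
      (Ioi ε ×ˢ Ioi (0 : ℝ))) :
    ∫ τ in Ioi ε, ∫ y in Ioi (0 : ℝ), (H τ y : ℂ) * f (t - τ, y) =
      ∫ p in Ioi ε ×ˢ Ioi (0 : ℝ), (H p.1 p.2 : ℂ) * F (t - p.1, p.2) := by
  rw [Measure.volume_eq_prod] at hi ⊢
  rw [setIntegral_prod _ hi]
  refine setIntegral_congr_fun measurableSet_Ioi fun τ _ => ?_
  refine setIntegral_congr_fun measurableSet_Ioi fun y hy => ?_
  simp only
  rw [hFf ⟨mem_univ _, hy⟩]

/-! ### Assembly of the theorem -/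

theorem theorem1p1 (μ : ℝ) (hμ : -1 < μ) (f : ℝ × ℝ → ℂ)
    (hf : IsBoundedCompactlySupported f) :
    -- the integral defining `u(t,x)` converges absolutely
    (∀ t x : ℝ, 0 < x →
      IntegrableOn (fun p : ℝ × ℝ => (besselHeatKernel μ p.1 x p.2 : ℂ) * f (t - p.1, p.2))
        (Ioi (0 : ℝ) ×ˢ Ioi (0 : ℝ))) ∧
    (ContDiffOn ℝ 2 f halfPlane → ∀ t x : ℝ, 0 < x →
      -- the derivatives of `u` exist
      DifferentiableAt ℝ (fun s => besselPotential μ f s x) t ∧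
      DifferentiableAt ℝ (fun z => besselPotential μ f t z) x ∧
      DifferentiableAt ℝ (deriv (fun z => besselPotential μ f t z)) x ∧
      -- the equation
      deriv (fun s => besselPotential μ f s x) t =
        besselOperator μ (fun z => besselPotential μ f t z) x + f (t, x) ∧
      -- the truncated integrals converge absolutely
      (∀ ε : ℝ, 0 < ε →
        IntegrableOn (fun p : ℝ × ℝ => (besselHeatKernelDt μ p.1 x p.2 : ℂ) * f (t - p.1, p.2))
          (Ioi ε ×ˢ Ioi (0 : ℝ)) ∧
        IntegrableOn (fun p : ℝ × ℝ => (besselHeatKernelDt μ p.1 x p.2 : ℂ) * f (t - p.1, p.2))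
          (parabolicRegion ε x) ∧
        IntegrableOn (fun p : ℝ × ℝ => (besselHeatKernelDxx μ p.1 x p.2 : ℂ) * f (t - p.1, p.2))
          (Ioi ε ×ˢ Ioi (0 : ℝ)) ∧
        IntegrableOn (fun p : ℝ × ℝ => (besselHeatKernelDxx μ p.1 x p.2 : ℂ) * f (t - p.1, p.2))
          (parabolicRegion ε x)) ∧
      -- the two representations of `∂u/∂t`
      Tendsto (fun ε : ℝ =>
          (∫ τ in Ioi ε, ∫ y in Ioi (0 : ℝ), (besselHeatKernelDt μ τ x y : ℂ) * f (t - τ, y))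
            + f (t, x))
        (𝓝[>] 0) (𝓝 (deriv (fun s => besselPotential μ f s x) t)) ∧
      Tendsto (fun ε : ℝ =>
          (∫ p in parabolicRegion ε x, (besselHeatKernelDt μ p.1 x p.2 : ℂ) * f (t - p.1, p.2))
            + (constA : ℂ) * f (t, x))
        (𝓝[>] 0) (𝓝 (deriv (fun s => besselPotential μ f s x) t)) ∧
      -- the two representations of `∂²u/∂x²`
      Tendsto (fun ε : ℝ =>
          ∫ τ in Ioi ε, ∫ y in Ioi (0 : ℝ), (besselHeatKernelDxx μ τ x y : ℂ) * f (t - τ, y))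
        (𝓝[>] 0) (𝓝 (deriv (deriv (fun z => besselPotential μ f t z)) x)) ∧
      Tendsto (fun ε : ℝ =>
          (∫ p in parabolicRegion ε x, (besselHeatKernelDxx μ p.1 x p.2 : ℂ) * f (t - p.1, p.2))
            - ((1 - constA : ℝ) : ℂ) * f (t, x))
        (𝓝[>] 0) (𝓝 (deriv (deriv (fun z => besselPotential μ f t z)) x))) := by
  refine ⟨fun t x hx => integrableOn_potential hμ hf t hx, fun hc t x hx => ?_⟩
  obtain ⟨F, F', a, R, M, M', hFf, hFd, hFs, hFs'⟩ := exists_smooth_extension hf hc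
  set T : ℝ := |t| + |R| + 1 with hT
  have hT0 : 0 < T := by positivity
  have hball : ∀ s ∈ Metric.ball t 1, s + R ≤ T := fun s hs => by
    have h1 := (abs_lt.1 (Real.dist_eq s t ▸ Metric.mem_ball.1 hs)).2
    linarith [le_abs_self t, le_abs_self R]
  have ht : t ∈ Metric.ball t 1 := Metric.mem_ball_self one_pos
  have h := hFs t T hT0 (hball t ht)
  have h' := hFs' t T hT0 (hball t ht)
  set φ : ℝ × ℝ → ℂ := fun p => F (t - p.1, p.2) with hφ
  set ψ : ℝ × ℝ → ℂ := fun p => F' (t - p.1, p.2) with hψ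
  have hd : ∀ τ y, HasDerivAt (fun s => φ (s, y)) (-ψ (τ, y)) τ := fun τ y =>
    (hFd (t - τ) y).comp_const_sub t τ
  have hφx : φ (0, x) = f (t, x) := by
    rw [hφ]
    simp only [sub_zero]
    exact hFf ⟨mem_univ _, hx⟩
  have hφf : ∀ p ∈ Ioi (0 : ℝ) ×ˢ Ioi (0 : ℝ), φ p = f (t - p.1, p.2) := fun p hp =>
    hFf ⟨mem_univ _, hp.2⟩
  have hdiff_t := (hasDerivAt_potential_time hμ hx
    (fun s hs => hFs s T hT0 (hball s hs)) (fun s hs => hFs' s T hT0 (hball s hs)) hFd)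
  have hpot : ∀ s ∈ Metric.ball t 1, ∀ z, 0 < z → besselPotential μ f s z =
      ∫ p in Ioi (0 : ℝ) ×ˢ Ioi (0 : ℝ),
        (besselHeatKernel μ p.1 z p.2 : ℂ) * F (s - p.1, p.2) := fun s hs z hz =>
    iterated_integral_eq hFf (fun τ y => besselHeatKernel μ τ z y) s 0
      ((hFs s T hT0 (hball s hs)).integrableOn_kernel_mul hμ hz)
  have hut : HasDerivAt (fun s => besselPotential μ f s x)
      (∫ p in Ioi (0 : ℝ) ×ˢ Ioi (0 : ℝ), (besselHeatKernel μ p.1 x p.2 : ℂ) * ψ p) t := by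
    refine hdiff_t.congr_of_eventuallyEq ?_
    filter_upwards [Metric.ball_mem_nhds t one_pos] with s hs
    exact hpot s hs x hx
  have hux : (fun z => besselPotential μ f t z) =ᶠ[𝓝 x] fun z =>
      ∫ p in Ioi (0 : ℝ) ×ˢ Ioi (0 : ℝ), (besselHeatKernel μ p.1 z p.2 : ℂ) * φ p := by
    filter_upwards [lt_mem_nhds hx] with z hz
    exact hpot t ht z hz
  obtain ⟨hu1, hu2⟩ := h.hasDerivAt_deriv_potential h' hd hμ hx
  have huxx := hu2.congr_of_eventuallyEq hux.deriv
  have hDt := continuousOn_kernel_slice (continuousOn_besselHeatKernelDt hμ) hx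
  have hDxx := continuousOn_kernel_slice (continuousOn_besselHeatKernelDxx hμ) hx
  have hmR : ∀ ε : ℝ, MeasurableSet (Ioi ε ×ˢ Ioi (0 : ℝ)) := fun ε =>
    measurableSet_Ioi.prod measurableSet_Ioi
  have hmS : ∀ ε : ℝ, MeasurableSet (Ioc 0 (ε ^ 2) ×ˢ awayFrom x ε) := fun ε =>
    measurableSet_Ioc.prod (measurableSet_awayFrom x ε)
  have hsubS : ∀ ε : ℝ, Ioc 0 (ε ^ 2) ×ˢ awayFrom x ε ⊆ Ioi (0 : ℝ) ×ˢ Ioi (0 : ℝ) := fun ε =>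
    prod_mono (fun τ hτ => hτ.1) (awayFrom_subset x ε)
  have hsubR : ∀ ε : ℝ, 0 < ε → Ioi ε ×ˢ Ioi (0 : ℝ) ⊆ Ioi (0 : ℝ) ×ˢ Ioi (0 : ℝ) := fun ε hε =>
    prod_mono (Ioi_subset_Ioi hε.le) Subset.rfl
  have hsubP : ∀ ε : ℝ, parabolicRegion ε x ⊆ Ioi (0 : ℝ) ×ˢ Ioi (0 : ℝ) := fun ε p hp =>
    ⟨hp.1, hp.2.1⟩
  have hmP : ∀ ε : ℝ, 0 < ε → MeasurableSet (parabolicRegion ε x) := fun ε hε => by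
    rw [parabolicRegion_eq hε]
    exact (hmR _).union (hmS ε)
  -- Through the heat equation, the short-time piece of ∂_x²W inherits integrability and its limit
  -- from those of ∂_τW and W.
  have hDxx_short : ∀ ε : ℝ, EqOn
      (fun p : ℝ × ℝ => (besselHeatKernelDt μ p.1 x p.2 : ℂ) * φ p -
        (((1 / 4 - μ ^ 2) / x ^ 2 : ℝ) : ℂ) * ((besselHeatKernel μ p.1 x p.2 : ℂ) * φ p))
      (fun p : ℝ × ℝ => (besselHeatKernelDxx μ p.1 x p.2 : ℂ) * φ p)
      (Ioc 0 (ε ^ 2) ×ˢ awayFrom x ε) := fun ε p hp => by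
    simp only
    rw [besselHeatKernelDxx_eq hμ (hsubS ε hp).1 hx (hsubS ε hp).2]
    push_cast
    ring
  have iDt_short : ∀ ε : ℝ, 0 < ε → IntegrableOn
      (fun p : ℝ × ℝ => (besselHeatKernelDt μ p.1 x p.2 : ℂ) * φ p)
      (Ioc 0 (ε ^ 2) ×ˢ awayFrom x ε) := fun ε hε =>
    h.integrableOn_Dt_short_time hμ (ε ^ 2) hx hε
  have iW_short : ∀ ε : ℝ, IntegrableOn
      (fun p : ℝ × ℝ => (((1 / 4 - μ ^ 2) / x ^ 2 : ℝ) : ℂ) *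
        ((besselHeatKernel μ p.1 x p.2 : ℂ) * φ p))
      (Ioc 0 (ε ^ 2) ×ˢ awayFrom x ε) := fun ε =>
    ((h.integrableOn_kernel_mul hμ hx).mono_set (hsubS ε)).const_mul _
  have iDxx_short : ∀ ε : ℝ, 0 < ε → IntegrableOn
      (fun p : ℝ × ℝ => (besselHeatKernelDxx μ p.1 x p.2 : ℂ) * φ p)
      (Ioc 0 (ε ^ 2) ×ˢ awayFrom x ε) := fun ε hε =>
    ((iDt_short ε hε).sub (iW_short ε)).congr_fun (hDxx_short ε) (hmS ε)
  have iDt_par : ∀ ε : ℝ, 0 < ε → IntegrableOn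
      (fun p : ℝ × ℝ => (besselHeatKernelDt μ p.1 x p.2 : ℂ) * φ p) (parabolicRegion ε x) :=
    fun ε hε => by
      rw [parabolicRegion_eq hε]
      exact (h.integrableOn_mul_of_pos_time hDt (by positivity)).union (iDt_short ε hε)
  have iDxx_par : ∀ ε : ℝ, 0 < ε → IntegrableOn
      (fun p : ℝ × ℝ => (besselHeatKernelDxx μ p.1 x p.2 : ℂ) * φ p) (parabolicRegion ε x) :=
    fun ε hε => by
      rw [parabolicRegion_eq hε]
      exact (h.integrableOn_mul_of_pos_time hDxx (by positivity)).union (iDxx_short ε hε)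
  have hcongr : ∀ H : ℝ → ℝ → ℝ → ℝ, EqOn (fun p : ℝ × ℝ => (H p.1 x p.2 : ℂ) * φ p)
      (fun p : ℝ × ℝ => (H p.1 x p.2 : ℂ) * f (t - p.1, p.2))
      (Ioi (0 : ℝ) ×ˢ Ioi (0 : ℝ)) := fun H p hp => by
    simp only
    rw [hφf p hp]
  have lDt := h.tendsto_integral_Dt h' hd hμ hx
  have lDxx := h.tendsto_integral_Dxx h' hd hμ hx
  have lDt_short := h.tendsto_integral_Dt_short_time h' hd hμ hx
  have lW_short := (tendsto_integral_short_time (h.integrableOn_kernel_mul hμ hx)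
    (measurableSet_awayFrom x) (awayFrom_subset x)).const_mul
      (((1 / 4 - μ ^ 2) / x ^ 2 : ℝ) : ℂ)
  rw [hφx] at lDt lDxx lDt_short huxx
  rw [hut.deriv, huxx.deriv]
  refine ⟨hut.differentiableAt, hu1.congr_of_eventuallyEq hux, huxx.differentiableAt, ?_, ?_, ?_,
    ?_, ?_, ?_⟩
  · rw [besselOperator, huxx.deriv, hpot t ht x hx]
    ring
  · intro ε hε
    exact ⟨(h.integrableOn_mul_of_pos_time hDt hε).congr_fun
        ((hcongr _).mono (hsubR ε hε)) (hmR ε),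
      (iDt_par ε hε).congr_fun ((hcongr _).mono (hsubP ε)) (hmP ε hε),
      (h.integrableOn_mul_of_pos_time hDxx hε).congr_fun
        ((hcongr _).mono (hsubR ε hε)) (hmR ε),
      (iDxx_par ε hε).congr_fun ((hcongr _).mono (hsubP ε)) (hmP ε hε)⟩
  · have key := lDt.add_const (f (t, x))
    rw [sub_add_cancel] at key
    refine key.congr' ?_
    filter_upwards [self_mem_nhdsWithin] with ε (hε : 0 < ε)
    rw [iterated_integral_eq hFf (fun τ y => besselHeatKernelDt μ τ x y) t ε
      (h.integrableOn_mul_of_pos_time hDt hε)]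
  · have key := ((lDt.comp tendsto_sq_nhdsGT_zero).add lDt_short).add_const ((constA : ℂ) * f (t, x))
    have e : ∀ v : ℂ, v - f (t, x) + ((1 - constA : ℝ) : ℂ) * f (t, x) +
        (constA : ℂ) * f (t, x) = v := fun v => by push_cast; ring
    rw [e] at key
    refine key.congr' ?_
    filter_upwards [self_mem_nhdsWithin] with ε (hε : 0 < ε)
    rw [← setIntegral_congr_fun (hmP ε hε) ((hcongr (besselHeatKernelDt μ)).mono (hsubP ε)),
      setIntegral_parabolicRegion hε (h.integrableOn_mul_of_pos_time hDt (by positivity))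
        (iDt_short ε hε)]
    rfl
  · refine lDxx.congr' ?_
    filter_upwards [self_mem_nhdsWithin] with ε (hε : 0 < ε)
    rw [iterated_integral_eq hFf (fun τ y => besselHeatKernelDxx μ τ x y) t ε
      (h.integrableOn_mul_of_pos_time hDxx hε)]
  · have key := ((lDxx.comp tendsto_sq_nhdsGT_zero).add (lDt_short.sub lW_short)).sub_const
      (((1 - constA : ℝ) : ℂ) * f (t, x))
    rw [mul_zero, sub_zero, add_sub_cancel_right] at key
    refine key.congr' ?_
    filter_upwards [self_mem_nhdsWithin] with ε (hε : 0 < ε)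
    rw [← setIntegral_congr_fun (hmP ε hε) ((hcongr (besselHeatKernelDxx μ)).mono (hsubP ε)),
      setIntegral_parabolicRegion hε (h.integrableOn_mul_of_pos_time hDxx (by positivity))
        (iDxx_short ε hε), ← setIntegral_congr_fun (hmS ε) (hDxx_short ε),
      integral_sub (iDt_short ε hε) (iW_short ε), integral_const_mul]
    rfl
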